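/- Let $P\subset\mathbb{C}$ be a set of $n$ points in general position (no three distinct points of $P$ are collinear). For $A\subseteq P$, write $\mathrm{int}(A)$ for the set of points of $P$ that lie in the topological interior of the convex hull $\mathrm{Conv}(A)$, and call $A$ convex if $\mathrm{int}(A)\cap A=\emptyset$. Suppose that $P$ has Property $\Delta_1$: $|\mathrm{int}(A)|\le |A|-2$ for every convex subset $A\subseteq P$ with $|A|\ge 3$. Let $\mathrm{NC}(P)$ be the set of noncrossing partitions of $P$, i.e. the partitions whose blocks have pairwise disjoint convex hulls, ordered by refinement, and for $\pi\in \mathrm{NC}(P)$ put $\rho(\pi)=n-\mathrm{bl}(\pi)$, where $\mathrm{bl}(\pi)$ is the number of blocks of $\pi$. Then $\mathrm{NC}(P)$ is a lattice, it is graded with rank function $\rho$ (so $\rho$ is strictly increasing, is $0$ at the minimum, and increases by exactly $1$ along every covering relation of $\mathrm{NC}(P)$), and, if $n\ge 1$, its maximum has rank $n-1$. It is rank-symmetric: for $0\le k\le n-1$ the number of elements of rank $k$ equals the number of elements of rank $n-1-k$. For $0\le k\le n-1$ the number of elements of rank $k$ (equivalently, with $n-k$ blocks) is the Narayana number $N_{n,k+1}$,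 where $N_{n,j}=\frac1n\binom{n}{j}\binom{n}{j-1}$ for $1\le j\le n$. In particular $|\mathrm{NC}(P)|=C_n=\frac{1}{n+1}\binom{2n}{n}=|\mathrm{NC}_n|$, where $\mathrm{NC}_n=\mathrm{NC}(Q)$ for $Q$ any set of $n$ points that is the vertex set of a convex $n$-gon (no point of $Q$ lies in the convex hull of the others). -/

import Mathlib

namespace PlanarNC

/-- No three distinct points of `P` are collinear. -/
def GeneralPosition (P : Finset ℂ) : Prop :=
  ∀ a ∈ P, ∀ b ∈ P, ∀ c ∈ P, a ≠ b → a ≠ c → b ≠ c → ¬ Collinear ℝ ({a, b, c} : Set ℂ)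

/-- The points of `P` lying in the topological interior of the convex hull of `A`. -/
def interiorPoints (P A : Finset ℂ) : Set ℂ :=
  interior (convexHull ℝ (A : Set ℂ)) ∩ (P : Set ℂ)

/-- `A` is convex: no point of `A` lies in the interior of the convex hull of `A`. -/
def IsConvexSubset (A : Finset ℂ) : Prop :=
  interiorPoints A A = ∅

/-- Property `Δ_k`: `P` is in general position and every convex subset `A` of `P` has at most
`(|A| - 3) + k` points of `P` in the interior of its convex hull. Sets `A` with fewer than three
points, whose convex hull has empty interior, are not constrained. -/
def PropertyDelta (k : ℕ) (P : Finset ℂ) : Prop :=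
  GeneralPosition P ∧
    ∀ A ⊆ P, 3 ≤ A.card → IsConvexSubset A → (interiorPoints P A).ncard ≤ (A.card - 3) + k

/-- `P` is the vertex set of a convex polygon: no point of `P` lies in the convex hull of the
other points. -/
def IsConvexPolygon (P : Finset ℂ) : Prop :=
  ∀ p ∈ P, p ∉ convexHull ℝ ((P : Set ℂ) \ {p})

/-- A partition of `P` is noncrossing if the convex hulls of its blocks are pairwise disjoint. -/
def IsNoncrossing {P : Finset ℂ} (π : Finpartition P) : Prop :=
  (π.parts : Set (Finset ℂ)).PairwiseDisjoint fun B => convexHull ℝ (B : Set ℂ)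

/-- The poset `NC(P)` of noncrossing partitions of `P`, ordered by refinement (the order of
`Finpartition`: `π ≤ σ` when every block of `π` is contained in a block of `σ`). -/
abbrev NC (P : Finset ℂ) : Type :=
  {π : Finpartition P // IsNoncrossing π}

/-- The rank of a partition: the number of points minus the number of blocks. -/
def rank {P : Finset ℂ} (π : NC P) : ℕ :=
  P.card - π.1.parts.card

/-- The number of noncrossing partitions of `P` of rank `k`. -/
noncomputable def rankCount (P : Finset ℂ) (k : ℕ) : ℕ :=
  {π : NC P | rank π = k}.ncard

/-- The Narayana number `N_{n,k} = (1/n) * binom(n,k) * binom(n,k-1)`, for `1 ≤ k ≤ n`. -/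
def narayana (n k : ℕ) : ℚ :=
  1 / (n : ℚ) * (n.choose k : ℚ) * (n.choose (k - 1) : ℚ)

end PlanarNC

/-! Property Δ_1 is needed only for triangles: a triangle with vertices in P has at most one point
of P in its interior (`TriangleCondition`). Choose an extreme point b of P, let Q = P \ {b}, and
order Q by slope as seen from b. A noncrossing partition of P either has {b} as a block or arises in
exactly one way from a noncrossing partition of Q by adding b to a visible block, one whose hull
together with b meets no other block.

Visibility depends on depth, but the number of visible blocks does not: by an exchange argument
(`card_visible_eq_card_uncovered`), where the triangle condition enters, it equals the number of
blocks whose largest slope is not strictly inside the slope interval of another block. These blocks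
correspond to the points q of Q for which a ray just past q separates the blocks. For fixed q, such
partitions are pairs of partitions of the points on the two sides. Exchanging the sums gives
`ncPoly_insert`, a recursion that sees only cardinalities, so the generating polynomial by blocks is
`narayanaPoly`. Its quadratic functional equation yields a three-term recurrence, which the Narayana
numbers satisfy too. Convex polygons satisfy the triangle condition vacuously, hence have the same
count.

Gradedness rests on `exists_isSplit`: a noncrossing partition with at least two blocks lies below
one with exactly two. Applied inside a block of σ that is not a block of π, it gives for π < σ an
element of [π, σ] with one block more than σ. Meets are blockwise intersections; joins follow from
finiteness and the maximum. -/

namespace PlanarNC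

/-! ### Slopes and depth of convex hulls seen from a point -/

/-- The coordinate of `x` seen from `b`, rotated and scaled by `w`. -/
noncomputable def viewCoord (b w x : ℂ) : ℂ := w * (x - b)

/-- The slope of the ray from `b` through `x`. -/
noncomputable def slope (b w x : ℂ) : ℝ := (viewCoord b w x).im / (viewCoord b w x).re

/-- From `b` the points of `Q` lie in an open half-plane and are seen in distinct directions. -/
structure IsView (b w : ℂ) (Q : Finset ℂ) : Prop where
  ne_zero : w ≠ 0
  pos : ∀ x ∈ Q, 0 < (viewCoord b w x).re
  inj : ∀ x ∈ Q, ∀ y ∈ Q, slope b w x = slope b w y → x = y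

noncomputable def leftSlope (b w : ℂ) (B : Finset ℂ) : ℝ := sInf (slope b w '' B)
noncomputable def rightSlope (b w : ℂ) (B : Finset ℂ) : ℝ := sSup (slope b w '' B)

/-- Some point of the hull of `A` lies on a segment from `b` to the hull of `D`. -/
def InFront (b : ℂ) (A D : Finset ℂ) : Prop :=
  (convexHull ℝ (A : Set ℂ) ∩ convexHull ℝ (insert b D : Finset ℂ)).Nonempty

variable {b w : ℂ} {Q A D E B : Finset ℂ}

theorem IsView.mono (h : IsView b w Q) (hA : A ⊆ Q) : IsView b w A :=
  ⟨h.ne_zero, fun x hx => h.pos x (hA hx), fun x hx y hy => h.inj x (hA hx) y (hA hy)⟩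

theorem viewCoord_comb (b w x y : ℂ) {s t : ℝ} (h : s + t = 1) :
    viewCoord b w (s • x + t • y) = s * viewCoord b w x + t * viewCoord b w y := by
  have h' : (s : ℂ) + t = 1 := by exact_mod_cast h
  simp only [viewCoord, Complex.real_smul]
  linear_combination (w * b) * h'

theorem viewCoord_self (b w : ℂ) : viewCoord b w b = 0 := by simp [viewCoord]

theorem viewCoord_inj (hw : w ≠ 0) {x y : ℂ} (h : viewCoord b w x = viewCoord b w y) : x = y := by
  have := mul_left_cancel₀ hw h
  linear_combination this

theorem convex_viewCoord_preimage (b w : ℂ) {K : Set ℂ} (hK : Convex ℝ K) :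
    Convex ℝ (viewCoord b w ⁻¹' K) := by
  intro x hx y hy s t hs ht hst
  have := hK hx hy hs ht hst
  rw [Set.mem_preimage, viewCoord_comb b w x y hst]
  simpa [Complex.real_smul] using this

theorem convex_sector (p q r s : ℝ) :
    Convex ℝ {z : ℂ | 0 < z.re ∧ p * z.re + q * z.im ≤ 0 ∧ r * z.re + s * z.im ≤ 0} := by
  rintro x ⟨h1, h2, h3⟩ y ⟨k1, k2, k3⟩ a b ha hb hab
  have hab' : 0 < a ∨ 0 < b := by
    by_contra! h
    linarith [h.1, h.2]
  refine ⟨?_, ?_, ?_⟩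
  · simp only [Complex.add_re, Complex.real_smul, Complex.mul_re, Complex.ofReal_re,
      Complex.ofReal_im, zero_mul, sub_zero]
    rcases hab' with h | h <;> positivity
  · simp only [Complex.add_re, Complex.add_im, Complex.real_smul, Complex.mul_re, Complex.mul_im,
      Complex.ofReal_re, Complex.ofReal_im, zero_mul, sub_zero, add_zero]
    linarith [mul_nonpos_of_nonneg_of_nonpos ha h2, mul_nonpos_of_nonneg_of_nonpos hb k2]
  · simp only [Complex.add_re, Complex.add_im, Complex.real_smul, Complex.mul_re, Complex.mul_im,
      Complex.ofReal_re, Complex.ofReal_im, zero_mul, sub_zero, add_zero]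
    linarith [mul_nonpos_of_nonneg_of_nonpos ha h3, mul_nonpos_of_nonneg_of_nonpos hb k3]

theorem exists_leftSlope (hA : A.Nonempty) : ∃ x ∈ A, slope b w x = leftSlope b w A := by
  have := (hA.to_set.image (slope b w)).csInf_mem (A.finite_toSet.image _)
  obtain ⟨x, hx, h⟩ := this
  exact ⟨x, hx, h⟩

theorem exists_rightSlope (hA : A.Nonempty) : ∃ x ∈ A, slope b w x = rightSlope b w A := by
  have := (hA.to_set.image (slope b w)).csSup_mem (A.finite_toSet.image _)
  obtain ⟨x, hx, h⟩ := this
  exact ⟨x, hx, h⟩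

theorem leftSlope_le {x : ℂ} (hx : x ∈ A) : leftSlope b w A ≤ slope b w x :=
  csInf_le (A.finite_toSet.image _).bddBelow ⟨x, hx, rfl⟩

theorem le_rightSlope {x : ℂ} (hx : x ∈ A) : slope b w x ≤ rightSlope b w A :=
  le_csSup (A.finite_toSet.image _).bddAbove ⟨x, hx, rfl⟩

theorem leftSlope_le_rightSlope (hA : A.Nonempty) : leftSlope b w A ≤ rightSlope b w A := by
  obtain ⟨x, hx⟩ := hA
  exact (leftSlope_le hx).trans (le_rightSlope hx)

/-- In the half-plane of positive real part, bounds on the slope are linear inequalities, so they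
pass to the hull. -/
theorem slope_mem_of_mem_hull (hv : IsView b w A) {x : ℂ} (hx : x ∈ convexHull ℝ (A : Set ℂ)) :
    0 < (viewCoord b w x).re ∧ leftSlope b w A ≤ slope b w x ∧ slope b w x ≤ rightSlope b w A := by
  have hsub : (A : Set ℂ) ⊆ viewCoord b w ⁻¹' {z : ℂ | 0 < z.re ∧
      leftSlope b w A * z.re + (-1) * z.im ≤ 0 ∧ (-rightSlope b w A) * z.re + 1 * z.im ≤ 0} := by
    intro y hy
    have h0 := hv.pos y hy
    have h1 := leftSlope_le (b := b) (w := w) hy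
    have h2 := le_rightSlope (b := b) (w := w) hy
    rw [slope, le_div_iff₀ h0] at h1
    rw [slope, div_le_iff₀ h0] at h2
    exact ⟨h0, by linarith, by linarith⟩
  have := convexHull_min hsub (convex_viewCoord_preimage b w (convex_sector _ _ _ _)) hx
  obtain ⟨h0, h1, h2⟩ := this
  refine ⟨h0, ?_, ?_⟩
  · rw [slope, le_div_iff₀ h0]; linarith
  · rw [slope, div_le_iff₀ h0]; linarith

theorem exists_mem_segment_slope_eq {p q : ℂ} (hp : 0 < (viewCoord b w p).re)
    (hq : 0 < (viewCoord b w q).re) {t : ℝ} (h1 : slope b w p ≤ t) (h2 : t ≤ slope b w q) :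
    ∃ x ∈ segment ℝ p q, 0 < (viewCoord b w x).re ∧ slope b w x = t := by
  rcases eq_or_lt_of_le h1 with h1 | h1
  · exact ⟨p, left_mem_segment ℝ p q, hp, h1⟩
  rw [slope, div_lt_iff₀ hp] at h1
  rw [slope, le_div_iff₀ hq] at h2
  set P := viewCoord b w p
  set R := viewCoord b w q
  -- The linear form `im - t * re` is nonnegative at q and negative at p; its absolute values, each
  -- attached to the opposite end, are the weights of its zero on the segment.
  have ha : 0 ≤ R.im - t * R.re := by linarith
  have hb : 0 < t * P.re - P.im := by linarith
  have hpos : 0 < (R.im - t * R.re) + (t * P.re - P.im) := by linarith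
  set N := (R.im - t * R.re) + (t * P.re - P.im) with hN
  have hsum : (R.im - t * R.re) / N + (t * P.re - P.im) / N = 1 := by
    rw [← add_div, div_self hpos.ne']
  have hc := viewCoord_comb b w p q hsum
  refine ⟨_, ⟨_, _, by positivity, by positivity, hsum, rfl⟩, ?_⟩
  have hre : 0 < (viewCoord b w (((R.im - t * R.re) / N) • p +
      ((t * P.re - P.im) / N) • q)).re := by
    rw [hc]
    simp only [Complex.add_re, Complex.mul_re, Complex.ofReal_re, Complex.ofReal_im, zero_mul,
      sub_zero]
    have h3 : 0 < (t * P.re - P.im) / N * R.re := by positivity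
    have h4 : 0 ≤ (R.im - t * R.re) / N * P.re := by positivity
    exact add_pos_of_nonneg_of_pos h4 h3
  refine ⟨hre, ?_⟩
  rw [slope, div_eq_iff hre.ne', hc]
  simp only [Complex.add_re, Complex.add_im, Complex.mul_re, Complex.mul_im, Complex.ofReal_re,
    Complex.ofReal_im, zero_mul, sub_zero, add_zero]
  change (R.im - t * R.re) / N * P.im + (t * P.re - P.im) / N * R.im =
    t * ((R.im - t * R.re) / N * P.re + (t * P.re - P.im) / N * R.re)
  ring

theorem exists_mem_hull_slope_eq (hv : IsView b w A) (hA : A.Nonempty) {t : ℝ}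
    (h1 : leftSlope b w A ≤ t) (h2 : t ≤ rightSlope b w A) :
    ∃ x ∈ convexHull ℝ (A : Set ℂ), 0 < (viewCoord b w x).re ∧ slope b w x = t := by
  obtain ⟨p, hp, hp'⟩ := exists_leftSlope (b := b) (w := w) hA
  obtain ⟨q, hq, hq'⟩ := exists_rightSlope (b := b) (w := w) hA
  obtain ⟨x, hx, h⟩ := exists_mem_segment_slope_eq (hv.pos p hp) (hv.pos q hq)
    (hp'.trans_le h1) (h2.trans_eq hq'.symm)
  exact ⟨x, segment_subset_convexHull (by exact_mod_cast hp) (by exact_mod_cast hq) hx, h⟩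

theorem viewCoord_eq_of_slope_eq {x y : ℂ} (hx : 0 < (viewCoord b w x).re)
    (hy : 0 < (viewCoord b w y).re) (h : slope b w x = slope b w y) :
    viewCoord b w x = ((viewCoord b w x).re / (viewCoord b w y).re : ℝ) * viewCoord b w y := by
  rw [slope, slope, div_eq_div_iff hx.ne' hy.ne'] at h
  apply Complex.ext
  · simp; field_simp
  · simp; field_simp; linarith

/-- The hull of b and D is the union of the segments from b to the hull of D, so being in front
becomes a comparison of depth along one ray. -/
theorem inFront_iff (hA : IsView b w A) (hD : D.Nonempty) :
    InFront b A D ↔ ∃ x ∈ convexHull ℝ (A : Set ℂ), ∃ y ∈ convexHull ℝ (D : Set ℂ),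
      ∃ τ : ℝ, 0 < τ ∧ τ ≤ 1 ∧ viewCoord b w x = τ * viewCoord b w y := by
  constructor
  · rintro ⟨x, hx, hx'⟩
    rw [Finset.coe_insert, convexHull_insert (by exact_mod_cast hD), convexJoin_singleton_left]
      at hx'
    simp only [Set.mem_iUnion] at hx'
    obtain ⟨y, hy, s, t, hs, ht, hst, rfl⟩ := hx'
    have hc := viewCoord_comb b w b y hst
    rw [viewCoord_self, mul_zero, zero_add] at hc
    refine ⟨_, hx, y, hy, t, ?_, by linarith, hc⟩
    have := (slope_mem_of_mem_hull hA hx).1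
    rcases eq_or_lt_of_le ht with h | h
    · rw [hc, ← h] at this; simp at this
    · exact h
  · rintro ⟨x, hx, y, hy, τ, h0, h1, h⟩
    refine ⟨x, hx, ?_⟩
    have hst : (1 - τ) + τ = 1 := by ring
    have hc := viewCoord_comb b w b y hst
    rw [viewCoord_self, mul_zero, zero_add, ← h] at hc
    rw [← viewCoord_inj hA.ne_zero hc]
    refine (convex_convexHull ℝ _) (subset_convexHull ℝ _ (by simp)) ?_ (by linarith) h0.le hst
    exact convexHull_mono (by simp) hy

theorem slope_eq_of_viewCoord_eq {x y : ℂ} {τ : ℝ} (h0 : 0 < τ)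
    (h : viewCoord b w x = τ * viewCoord b w y) : slope b w x = slope b w y := by
  rw [slope, slope, h]
  simp only [Complex.mul_re, Complex.mul_im, Complex.ofReal_re, Complex.ofReal_im, zero_mul,
    sub_zero, add_zero]
  exact mul_div_mul_left _ _ h0.ne'

theorem inFront_of_slope_eq (hA : IsView b w A) (hD : D.Nonempty) {x y : ℂ}
    (hx : x ∈ convexHull ℝ (A : Set ℂ)) (hy : y ∈ convexHull ℝ (D : Set ℂ))
    (hx0 : 0 < (viewCoord b w x).re) (hs : slope b w x = slope b w y)
    (hle : (viewCoord b w x).re ≤ (viewCoord b w y).re) : InFront b A D := by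
  have hy0 := hx0.trans_le hle
  rw [inFront_iff hA hD]
  exact ⟨x, hx, y, hy, _, div_pos hx0 hy0, (div_le_one hy0).2 hle,
    viewCoord_eq_of_slope_eq hx0 hy0 hs⟩

theorem InFront.overlap (hA : IsView b w A) (hD : IsView b w D) (hD' : D.Nonempty)
    (h : InFront b A D) :
    leftSlope b w A ≤ rightSlope b w D ∧ leftSlope b w D ≤ rightSlope b w A := by
  obtain ⟨x, hx, y, hy, τ, h0, h1, h⟩ := (inFront_iff hA hD').1 h
  have hs := slope_eq_of_viewCoord_eq h0 h
  obtain ⟨-, h1, h2⟩ := slope_mem_of_mem_hull hA hx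
  obtain ⟨-, h3, h4⟩ := slope_mem_of_mem_hull hD hy
  constructor <;> linarith

/-- The ray at the larger of the two left slopes meets both hulls, and the nearer point on it
decides. -/
theorem inFront_or_inFront (hA : IsView b w A) (hD : IsView b w D) (hA' : A.Nonempty)
    (hD' : D.Nonempty) (h1 : leftSlope b w A ≤ rightSlope b w D)
    (h2 : leftSlope b w D ≤ rightSlope b w A) : InFront b A D ∨ InFront b D A := by
  obtain ⟨x, hx, hx0, hxs⟩ := exists_mem_hull_slope_eq hA hA'
    (t := max (leftSlope b w A) (leftSlope b w D)) (le_max_left _ _)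
    (max_le (leftSlope_le_rightSlope hA') h2)
  obtain ⟨y, hy, hy0, hys⟩ := exists_mem_hull_slope_eq hD hD'
    (t := max (leftSlope b w A) (leftSlope b w D)) (le_max_right _ _)
    (max_le h1 (leftSlope_le_rightSlope hD'))
  rcases le_total (viewCoord b w x).re (viewCoord b w y).re with h | h
  · exact Or.inl (inFront_of_slope_eq hA hD' hx hy hx0 (hxs.trans hys.symm) h)
  · exact Or.inr (inFront_of_slope_eq hD hA' hy hx hy0 (hys.trans hxs.symm) h)

/-- If each hid part of the other, the depth order would be reversed between two rays, and a segment
in one hull would cross a segment in the other. -/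
theorem InFront.asymm (hA : IsView b w A) (hD : IsView b w D) (hA' : A.Nonempty)
    (hD' : D.Nonempty)
    (hdisj : Disjoint (convexHull ℝ (A : Set ℂ)) (convexHull ℝ (D : Set ℂ)))
    (h1 : InFront b A D) : ¬ InFront b D A := by
  intro h2
  obtain ⟨x, hx, y, hy, τ, t0, t1, h⟩ := (inFront_iff hA hD').1 h1
  obtain ⟨y', hy', x', hx', σ, s0, s1, h'⟩ := (inFront_iff hD hA').1 h2
  rw [Set.disjoint_left] at hdisj
  rcases eq_or_lt_of_le t1 with rfl | t1
  · have : x = y := viewCoord_inj hA.ne_zero (by simpa using h)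
    exact hdisj hx (this ▸ hy)
  have ha : 0 ≤ 1 - σ := by linarith
  have hb : 0 < σ * (1 - τ) := mul_pos s0 (by linarith)
  have hN : 0 < (1 - σ) + σ * (1 - τ) := by linarith
  -- N = 1 - στ. The weights are chosen so that the two combinations agree, given that from b one
  -- sees x = τ y and y' = σ x'.
  set N := (1 - σ) + σ * (1 - τ) with hNdef
  have e1 : (1 - σ) / N + σ * (1 - τ) / N = 1 := by rw [← add_div, div_self hN.ne']
  have e2 : (1 - σ) * τ / N + (1 - τ) / N = 1 := by
    rw [← add_div, div_eq_one_iff_eq hN.ne']; ring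
  have m1 := (convex_convexHull ℝ (A : Set ℂ)) hx hx' (by positivity) (by positivity) e1
  have m2 := (convex_convexHull ℝ (D : Set ℂ)) hy hy'
    (a := (1 - σ) * τ / N) (b := (1 - τ) / N) (by positivity)
    (div_nonneg (by linarith) hN.le) e2
  have c1 := viewCoord_comb b w x x' e1
  have c2 := viewCoord_comb b w y y' e2
  have : ((1 - σ) / N) • x + (σ * (1 - τ) / N) • x' =
      ((1 - σ) * τ / N) • y + ((1 - τ) / N) • y' := by
    apply viewCoord_inj (b := b) hA.ne_zero
    rw [c1, c2, h, h']
    push_cast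
    ring
  exact hdisj m1 (this ▸ m2)

theorem InFront.re_lt (hA : IsView b w A) (hD : IsView b w D) (hA' : A.Nonempty)
    (hD' : D.Nonempty)
    (hdisj : Disjoint (convexHull ℝ (A : Set ℂ)) (convexHull ℝ (D : Set ℂ)))
    (h : InFront b A D) {x y : ℂ} (hx : x ∈ convexHull ℝ (A : Set ℂ))
    (hy : y ∈ convexHull ℝ (D : Set ℂ)) (hs : slope b w x = slope b w y) :
    (viewCoord b w x).re < (viewCoord b w y).re := by
  by_contra! hle
  exact h.asymm hA hD hA' hD' hdisj
    (inFront_of_slope_eq hD hA' hy hx (slope_mem_of_mem_hull hD hy).1 hs.symm hle)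

/-- Depth is compared on one ray meeting all three hulls. Without such a ray transitivity can fail,
since A and E need not overlap in slope. -/
theorem InFront.trans_of_common_slope (hA : IsView b w A) (hD : IsView b w D) (hE : IsView b w E)
    (hA' : A.Nonempty) (hD' : D.Nonempty) (hE' : E.Nonempty)
    (hAD : Disjoint (convexHull ℝ (A : Set ℂ)) (convexHull ℝ (D : Set ℂ)))
    (hDE : Disjoint (convexHull ℝ (D : Set ℂ)) (convexHull ℝ (E : Set ℂ)))
    (h1 : InFront b A D) (h2 : InFront b D E) {t : ℝ}
    (a1 : leftSlope b w A ≤ t) (a2 : t ≤ rightSlope b w A)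
    (d1 : leftSlope b w D ≤ t) (d2 : t ≤ rightSlope b w D)
    (e1 : leftSlope b w E ≤ t) (e2 : t ≤ rightSlope b w E) : InFront b A E := by
  obtain ⟨x, hx, hx0, hxs⟩ := exists_mem_hull_slope_eq hA hA' a1 a2
  obtain ⟨y, hy, hy0, hys⟩ := exists_mem_hull_slope_eq hD hD' d1 d2
  obtain ⟨z, hz, hz0, hzs⟩ := exists_mem_hull_slope_eq hE hE' e1 e2
  have k1 := h1.re_lt hA hD hA' hD' hAD hx hy (hxs.trans hys.symm)
  have k2 := h2.re_lt hD hE hD' hE' hDE hy hz (hys.trans hzs.symm)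
  exact inFront_of_slope_eq hA hE' hx hz hx0 (hxs.trans hzs.symm) (k1.trans k2).le

/-- In coordinates α, β with origin b and axes towards p and q, the open triangle is α > 0, β > 0, α
+ β < 1. The slopes give the first two conditions, the depth gives the third. -/
theorem mem_interior_triangle {p q a : ℂ} (hw : w ≠ 0) (hp : 0 < (viewCoord b w p).re)
    (hq : 0 < (viewCoord b w q).re) (ha : 0 < (viewCoord b w a).re)
    (h1 : slope b w p < slope b w a) (h2 : slope b w a < slope b w q)
    (hfront : ∀ y ∈ segment ℝ p q, slope b w a = slope b w y →
      (viewCoord b w a).re < (viewCoord b w y).re) :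
    a ∈ interior (convexHull ℝ ({b, p, q} : Set ℂ)) := by
  set P := viewCoord b w p with hPdef
  set R := viewCoord b w q with hRdef
  have hPR : 0 < P.re * R.im - P.im * R.re := by
    have := h1.trans h2
    rw [slope, slope, div_lt_div_iff₀ hp hq] at this
    linarith
  set N := P.re * R.im - P.im * R.re with hN
  let α : ℂ → ℝ := fun x =>
    ((viewCoord b w x).re * R.im - (viewCoord b w x).im * R.re) / N
  let β : ℂ → ℝ := fun x =>
    (P.re * (viewCoord b w x).im - P.im * (viewCoord b w x).re) / N
  have hrep : ∀ x, viewCoord b w x = α x * P + β x * R := by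
    intro x
    apply Complex.ext
    · simp only [α, β, Complex.add_re, Complex.mul_re, Complex.ofReal_re, Complex.ofReal_im,
        zero_mul, sub_zero]
      field_simp
      rw [hN]; ring
    · simp only [α, β, Complex.add_im, Complex.mul_im, Complex.ofReal_re, Complex.ofReal_im,
        zero_mul, add_zero]
      field_simp
      rw [hN]; ring
  have hcont : Continuous (viewCoord b w) := by unfold viewCoord; fun_prop
  have hα : Continuous α := by simp only [α]; fun_prop
  have hβ : Continuous β := by simp only [β]; fun_prop
  refine interior_maximal (s := convexHull ℝ ({b, p, q} : Set ℂ))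
    (t := {x | 0 < α x ∧ 0 < β x ∧ α x + β x < 1}) ?_ ?_ ⟨?_, ?_, ?_⟩
  · rintro x ⟨x1, x2, x3⟩
    have hx : x = ∑ i : Fin 3, (![1 - α x - β x, α x, β x] i) • (![b, p, q] i) := by
      simp only [Fin.sum_univ_three, Matrix.cons_val_zero, Matrix.cons_val_one,
        Matrix.cons_val_two, Matrix.tail_cons, Matrix.head_cons]
      apply viewCoord_inj (b := b) hw
      rw [hrep x, hPdef, hRdef]
      simp only [viewCoord, Complex.real_smul]
      simp
      ring
    rw [hx]
    refine (convex_convexHull ℝ _).sum_mem ?_ ?_ ?_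
    · intro i _
      fin_cases i <;> simp <;> linarith
    · simp only [Fin.sum_univ_three, Matrix.cons_val_zero, Matrix.cons_val_one,
        Matrix.cons_val_two, Matrix.tail_cons, Matrix.head_cons]
      ring
    · intro i _
      apply subset_convexHull
      fin_cases i <;> simp
  · exact (isOpen_lt continuous_const hα).inter ((isOpen_lt continuous_const hβ).inter
      (isOpen_lt (hα.add hβ) continuous_const))
  · rw [slope, slope, div_lt_div_iff₀ ha hq] at h2
    exact div_pos (by linarith) hPR
  · rw [slope, slope, div_lt_div_iff₀ hp ha] at h1
    exact div_pos (by linarith) hPR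
  · obtain ⟨y, hy, hy0, hys⟩ := exists_mem_segment_slope_eq hp hq h1.le h2.le
    have hlt := hfront y hy hys.symm
    have hya := viewCoord_eq_of_slope_eq ha hy0 hys.symm
    set τ := (viewCoord b w a).re / (viewCoord b w y).re with hτ
    have hτ1 : τ < 1 := (div_lt_one hy0).2 hlt
    obtain ⟨s, t, hs, ht, hst, rfl⟩ := hy
    have hc := viewCoord_comb b w p q hst
    -- The form α + β equals 1 on the line through p and q, so at a it is the depth ratio.
    have e1 : α a + β a = τ := by
      simp only [α, β]
      rw [hya, hc]
      simp only [Complex.add_re, Complex.add_im, Complex.mul_re, Complex.mul_im,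
        Complex.ofReal_re, Complex.ofReal_im, zero_mul, sub_zero, add_zero]
      rw [← add_div, div_eq_iff hPR.ne']
      change τ * (s * P.re + t * R.re) * R.im - τ * (s * P.im + t * R.im) * R.re +
        (P.re * (τ * (s * P.im + t * R.im)) - P.im * (τ * (s * P.re + t * R.re))) = τ * N
      have : t = 1 - s := by linarith
      rw [this, hN]; ring
    show α a + β a < 1
    linarith

end PlanarNC

/-! ### Counting visible intervals by uncovered right ends -/

namespace PlanarNC

/-- Provides the nearest of the intervals met by one ray, on which being in front is a total order.
-/
theorem exists_least_of_total {ι : Type*} [DecidableEq ι] (F : ι → ι → Prop) (O : Finset ι)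
    (hne : O.Nonempty)
    (htot : ∀ i ∈ O, ∀ j ∈ O, i ≠ j → F i j ∨ F j i)
    (htrans : ∀ i ∈ O, ∀ j ∈ O, ∀ k ∈ O, i ≠ j → j ≠ k → i ≠ k → F i j → F j k → F i k) :
    ∃ i ∈ O, ∀ j ∈ O, j ≠ i → F i j := by
  induction hne using Finset.Nonempty.cons_induction with
  | singleton a => exact ⟨a, by simp, fun j hj hne => absurd (by simpa using hj) hne⟩
  | cons a s ha hs ih =>
    obtain ⟨i, hi, h⟩ := ih
      (fun i hi j hj => htot i (Finset.mem_cons_of_mem hi) j (Finset.mem_cons_of_mem hj))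
      (fun i hi j hj k hk => htrans i (Finset.mem_cons_of_mem hi) j (Finset.mem_cons_of_mem hj)
        k (Finset.mem_cons_of_mem hk))
    have hia : i ≠ a := fun h => ha (h ▸ hi)
    rcases htot i (Finset.mem_cons_of_mem hi) a (Finset.mem_cons_self a s) hia with hF | hF
    · refine ⟨i, Finset.mem_cons_of_mem hi, fun j hj hji => ?_⟩
      rcases Finset.mem_cons.1 hj with rfl | hj
      · exact hF
      · exact h j hj hji
    · refine ⟨a, Finset.mem_cons_self a s, fun j hj hja => ?_⟩
      rcases Finset.mem_cons.1 hj with rfl | hj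
      · exact absurd rfl hja
      · by_cases hji : j = i
        · exact hji ▸ hF
        · exact htrans a (Finset.mem_cons_self a s) i (Finset.mem_cons_of_mem hi) j
            (Finset.mem_cons_of_mem hj) hia.symm (Ne.symm hji) (Ne.symm hja) hF (h j hj hji)

open Classical in
/-- For intervals `[l i, r i]` in a line, seen from one side, with `F i j` meaning that `i` hides a
part of `j`: if no interval has both a right end and a left end of intervals in front of it inside
it, then the number of fully visible intervals is the number of right ends not covered by another
interval. -/
theorem card_visible_eq_card_uncovered {ι : Type*} (F : ι → ι → Prop)
    (l r : ι → ℝ) (S : Finset ι)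
    (hlr : ∀ i ∈ S, l i ≤ r i)
    (hrr : ∀ i ∈ S, ∀ j ∈ S, i ≠ j → r i ≠ r j)
    (hll : ∀ i ∈ S, ∀ j ∈ S, i ≠ j → l i ≠ r j)
    (hover : ∀ i ∈ S, ∀ j ∈ S, i ≠ j → l i ≤ r j → l j ≤ r i → F i j ∨ F j i)
    (hF : ∀ i ∈ S, ∀ j ∈ S, i ≠ j → F i j → l i ≤ r j ∧ l j ≤ r i)
    (hasymm : ∀ i ∈ S, ∀ j ∈ S, i ≠ j → F i j → ¬ F j i)
    (htrans : ∀ i ∈ S, ∀ j ∈ S, ∀ k ∈ S, i ≠ j → j ≠ k → i ≠ k → ∀ t, l i ≤ t → t ≤ r i →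
      l j ≤ t → t ≤ r j → l k ≤ t → t ≤ r k → F i j → F j k → F i k)
    (htri : ∀ i ∈ S, ∀ j ∈ S, ∀ k ∈ S, i ≠ j → k ≠ j → i ≠ k → F i j → F k j →
      l j < r i → r i < r j → l j < l k → l k < r j → False) :
    (S.filter fun i => ∀ j ∈ S, j ≠ i → ¬ F j i).card =
      (S.filter fun i => ∀ j ∈ S, j ≠ i → ¬ (l j < r i ∧ r i < r j)).card := by
  induction hn : S.card generalizing S with
  | zero => rw [Finset.card_eq_zero.1 hn]; simp
  | succ n ih =>
    have hne : S.Nonempty := Finset.card_pos.1 (by omega)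
    -- The interval with the smallest right end covers no other right end, so deleting it leaves the
    -- other intervals covered or uncovered as before.
    obtain ⟨A, hA, hmin⟩ := S.exists_min_image r hne
    have hmin' : ∀ j ∈ S, j ≠ A → r A < r j := fun j hj hjA =>
      lt_of_le_of_ne (hmin j hj) (hrr A hA j hj (Ne.symm hjA))
    set T := S.erase A with hT
    have hTS : ∀ i ∈ T, i ∈ S := fun i hi => Finset.mem_of_mem_erase hi
    have hTA : ∀ i ∈ T, i ≠ A := fun i hi => Finset.ne_of_mem_erase hi
    have hST : ∀ i ∈ S, i ≠ A → i ∈ T := fun i hi h => Finset.mem_erase.2 ⟨h, hi⟩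
    have ih' := ih T (fun i hi => hlr i (hTS i hi))
      (fun i hi j hj => hrr i (hTS i hi) j (hTS j hj))
      (fun i hi j hj => hll i (hTS i hi) j (hTS j hj))
      (fun i hi j hj => hover i (hTS i hi) j (hTS j hj))
      (fun i hi j hj => hF i (hTS i hi) j (hTS j hj))
      (fun i hi j hj => hasymm i (hTS i hi) j (hTS j hj))
      (fun i hi j hj k hk => htrans i (hTS i hi) j (hTS j hj) k (hTS k hk))
      (fun i hi j hj k hk => htri i (hTS i hi) j (hTS j hj) k (hTS k hk))
      (by rw [hT, Finset.card_erase_of_mem hA]; omega)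
    set V := S.filter fun i => ∀ j ∈ S, j ≠ i → ¬ F j i with hV
    set C := S.filter fun i => ∀ j ∈ S, j ≠ i → ¬ (l j < r i ∧ r i < r j) with hC
    set V' := T.filter fun i => ∀ j ∈ T, j ≠ i → ¬ F j i with hV'
    set C' := T.filter fun i => ∀ j ∈ T, j ≠ i → ¬ (l j < r i ∧ r i < r j) with hC'
    have mV : ∀ i, i ∈ V ↔ i ∈ S ∧ ∀ j ∈ S, j ≠ i → ¬ F j i := fun i => Finset.mem_filter
    have mC : ∀ i, i ∈ C ↔ i ∈ S ∧ ∀ j ∈ S, j ≠ i → ¬ (l j < r i ∧ r i < r j) :=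
      fun i => Finset.mem_filter
    have mV' : ∀ i, i ∈ V' ↔ i ∈ T ∧ ∀ j ∈ T, j ≠ i → ¬ F j i := fun i => Finset.mem_filter
    have mC' : ∀ i, i ∈ C' ↔ i ∈ T ∧ ∀ j ∈ T, j ≠ i → ¬ (l j < r i ∧ r i < r j) :=
      fun i => Finset.mem_filter
    have hAV' : A ∉ V' := fun h => hTA A ((mV' A).1 h).1 rfl
    have hAC' : A ∉ C' := fun h => hTA A ((mC' A).1 h).1 rfl
    have hCC : ∀ i ∈ T, (i ∈ C ↔ i ∈ C') := by
      intro i hi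
      rw [mC, mC']
      refine ⟨fun h => ⟨hi, fun j hj => h.2 j (hTS j hj)⟩, fun h => ⟨hTS i hi, fun j hj hji => ?_⟩⟩
      by_cases hjA : j = A
      · subst hjA
        intro h'
        exact absurd h'.2 (not_lt.2 (hmin i (hTS i hi)))
      · exact h.2 j (hST j hj hjA) hji
    -- As `r A` is the least right end, O consists of the intervals having `r A` strictly inside.
    set O := T.filter fun j => l j < r A with hO
    have mO : ∀ i, i ∈ O ↔ i ∈ T ∧ l i < r A := fun i => Finset.mem_filter
    rcases O.eq_empty_or_nonempty with hOe | hOne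
    -- A overlaps nothing: it is visible and uncovered, and both counts grow by one.
    · have hno : ∀ j ∈ T, r A < l j := by
        intro j hj
        by_contra! h
        have : j ∈ O := (mO j).2 ⟨hj, lt_of_le_of_ne h (hll j (hTS j hj) A hA (hTA j hj))⟩
        simp [hOe] at this
      have hnF : ∀ j ∈ T, ¬ F A j ∧ ¬ F j A := by
        intro j hj
        have := hno j hj
        exact ⟨fun h => by linarith [(hF A hA j (hTS j hj) (hTA j hj).symm h).2],
          fun h => by linarith [(hF j (hTS j hj) A hA (hTA j hj) h).1]⟩
      have e1 : V = insert A V' := by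
        ext i
        rw [Finset.mem_insert, mV, mV']
        constructor
        · rintro ⟨h1, h2⟩
          by_cases hi : i = A
          · exact Or.inl hi
          · exact Or.inr ⟨hST i h1 hi, fun j hj => h2 j (hTS j hj)⟩
        · rintro (rfl | ⟨h1, h2⟩)
          · exact ⟨hA, fun j hj hji => (hnF j (hST j hj hji)).2⟩
          · refine ⟨hTS i h1, fun j hj hji => ?_⟩
            by_cases hjA : j = A
            · exact hjA ▸ (hnF i h1).1
            · exact h2 j (hST j hj hjA) hji
      have e2 : C = insert A C' := by
        ext i
        rw [Finset.mem_insert]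
        by_cases hi : i = A
        · subst hi
          refine ⟨fun _ => Or.inl rfl, fun _ => (mC i).2 ⟨hA, fun j hj hji h => ?_⟩⟩
          linarith [hno j (hST j hj hji), h.1]
        · constructor
          · intro h
            exact Or.inr ((hCC i (hST i ((mC i).1 h).1 hi)).1 h)
          · rintro (h | h)
            · exact absurd h hi
            · exact (hCC i ((mC' i).1 h).1).2 h
      rw [e1, e2, Finset.card_insert_of_notMem hAV', Finset.card_insert_of_notMem hAC', ih']
    · have hOT : ∀ i ∈ O, i ∈ T := fun i hi => ((mO i).1 hi).1
      have hOr : ∀ i ∈ O, r A < r i := fun i hi =>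
        hmin' i (hTS i (hOT i hi)) (hTA i (hOT i hi))
      have hOl : ∀ i ∈ O, l i < r A := fun i hi => ((mO i).1 hi).2
      have e2 : C = C' := by
        ext i
        by_cases hi : i = A
        · subst hi
          refine ⟨fun h => ?_, fun h => absurd h hAC'⟩
          obtain ⟨j, hj⟩ := hOne
          exact absurd ⟨hOl j hj, hOr j hj⟩
            (((mC i).1 h).2 j (hTS j (hOT j hj)) (hTA j (hOT j hj)))
        · constructor
          · intro h
            exact (hCC i (hST i ((mC i).1 h).1 hi)).1 h
          · intro h
            exact (hCC i ((mC' i).1 h).1).2 h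
      rw [e2, ← ih']
      -- The nearest member of O on the ray at `r A`. Since A is covered, the number of visible
      -- intervals must not change when A is put back.
      obtain ⟨j0, hj0, hfirst⟩ := exists_least_of_total F O hOne
        (fun i hi j hj hij => hover i (hTS i (hOT i hi)) j (hTS j (hOT j hj)) hij
          (by linarith [hOl i hi, hOr j hj]) (by linarith [hOl j hj, hOr i hi]))
        (fun i hi j hj k hk hij hjk hik => htrans i (hTS i (hOT i hi)) j (hTS j (hOT j hj))
          k (hTS k (hOT k hk)) hij hjk hik (r A) (hOl i hi).le (hOr i hi).le (hOl j hj).le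
          (hOr j hj).le (hOl k hk).le (hOr k hk).le)
      have hj0S := hTS j0 (hOT j0 hj0)
      have hj0A := hTA j0 (hOT j0 hj0)
      have hFO : ∀ j ∈ T, F A j → j ∈ O := fun j hj h => by
        refine (mO j).2 ⟨hj, lt_of_le_of_ne (hF A hA j (hTS j hj) (hTA j hj).symm h).2
          (hll j (hTS j hj) A hA (hTA j hj))⟩
      rcases hover A hA j0 hj0S hj0A.symm (by linarith [hlr A hA, hOr j0 hj0]) (hOl j0 hj0).le
        with hAF | hAF
      -- A replaces j0 among the visible intervals: whatever A hides belongs to O, so it is j0 or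
      -- was already hidden by j0.
      · have hAall : ∀ j ∈ O, F A j := by
          intro j hj
          by_cases h : j = j0
          · exact h ▸ hAF
          · exact htrans A hA j0 hj0S j (hTS j (hOT j hj)) hj0A.symm (Ne.symm h)
              (hTA j (hOT j hj)).symm (r A) (hlr A hA) le_rfl (hOl j0 hj0).le (hOr j0 hj0).le
              (hOl j hj).le (hOr j hj).le hAF (hfirst j hj h)
        -- A member of O hiding j0 contradicts the choice of j0. Any other interval hiding j0 starts
        -- beyond `r A` and inside j0, which `htri` excludes alongside A.
        have hj0V' : j0 ∈ V' := by
          refine (mV' j0).2 ⟨hOT j0 hj0, fun E hE hEj hFE => ?_⟩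
          by_cases hEO : E ∈ O
          · exact hasymm E (hTS E hE) j0 hj0S hEj hFE (hfirst E hEO hEj)
          · have hlE : r A < l E := by
              by_contra! h
              exact hEO ((mO E).2 ⟨hE, lt_of_le_of_ne h (hll E (hTS E hE) A hA (hTA E hE))⟩)
            refine htri A hA j0 hj0S E (hTS E hE) hj0A.symm hEj (hTA E hE).symm hAF hFE
              (hOl j0 hj0) (hOr j0 hj0) ((hOl j0 hj0).trans hlE) ?_
            exact lt_of_le_of_ne (hF E (hTS E hE) j0 hj0S hEj hFE).1
              (hll E (hTS E hE) j0 hj0S hEj)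
        have e1 : V = insert A (V'.erase j0) := by
          ext i
          rw [Finset.mem_insert, Finset.mem_erase, mV, mV']
          constructor
          · rintro ⟨h1, h2⟩
            by_cases hi : i = A
            · exact Or.inl hi
            · refine Or.inr ⟨?_, hST i h1 hi, fun j hj => h2 j (hTS j hj)⟩
              rintro rfl
              exact h2 A hA (Ne.symm hi) hAF
          · rintro (rfl | ⟨h0, h1, h2⟩)
            · refine ⟨hA, fun j hj hji hFj => ?_⟩
              have hjO : j ∈ O := by
                refine (mO j).2 ⟨hST j hj hji, lt_of_le_of_ne
                  (hF j hj i hA hji hFj).1 (hll j hj i hA hji)⟩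
              exact hasymm i hA j hj (Ne.symm hji) (hAall j hjO) hFj
            · refine ⟨hTS i h1, fun j hj hji => ?_⟩
              by_cases hjA : j = A
              · subst hjA
                intro hFj
                exact h2 j0 (hOT j0 hj0) (Ne.symm h0) (hfirst i (hFO i h1 hFj) h0)
              · exact h2 j (hST j hj hjA) hji
        rw [e1, Finset.card_insert_of_notMem
          (fun h => hAV' (Finset.mem_of_mem_erase h)), Finset.card_erase_of_mem hj0V']
        have : 0 < V'.card := Finset.card_pos.2 ⟨j0, hj0V'⟩
        omega
      -- Here j0 hides A, and whatever A hides is a member of O other than j0, hence already hidden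
      -- by j0.
      · congr 1
        ext i
        rw [mV, mV']
        constructor
        · rintro ⟨h1, h2⟩
          have hi : i ≠ A := by
            rintro rfl
            exact h2 j0 hj0S hj0A hAF
          exact ⟨hST i h1 hi, fun j hj => h2 j (hTS j hj)⟩
        · rintro ⟨h1, h2⟩
          refine ⟨hTS i h1, fun j hj hji => ?_⟩
          by_cases hjA : j = A
          · subst hjA
            intro hFj
            by_cases hi : i = j0
            · subst hi
              exact hasymm i hj0S j hA hj0A hAF hFj
            · exact h2 j0 (hOT j0 hj0) (Ne.symm hi) (hfirst i (hFO i h1 hFj) hi)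
          · exact h2 j (hST j hj hjA) hji

end PlanarNC

/-! ### Noncrossing families and their visible blocks -/

namespace PlanarNC

/-- No two distinct points of `P` lie in the interior of a triangle with vertices in `P`. -/
def TriangleCondition (P : Finset ℂ) : Prop :=
  ∀ a ∈ P, ∀ b ∈ P, ∀ c ∈ P, a ≠ b → a ≠ c → b ≠ c → ∀ x ∈ P, ∀ y ∈ P,
    x ∈ interior (convexHull ℝ ({a, b, c} : Set ℂ)) →
    y ∈ interior (convexHull ℝ ({a, b, c} : Set ℂ)) → x = y

/-- The family `S` of nonempty sets covers `P` and has pairwise disjoint convex hulls. -/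
structure IsNCFamily (P : Finset ℂ) (S : Finset (Finset ℂ)) : Prop where
  nonempty : ∀ B ∈ S, B.Nonempty
  disj : ∀ A ∈ S, ∀ B ∈ S, A ≠ B →
    Disjoint (convexHull ℝ (A : Set ℂ)) (convexHull ℝ (B : Set ℂ))
  mem_iff : ∀ x, x ∈ P ↔ ∃ B ∈ S, x ∈ B

def IsVisible (b : ℂ) (S : Finset (Finset ℂ)) (B : Finset ℂ) : Prop :=
  ∀ A ∈ S, A ≠ B → ¬ InFront b A B

def IsUncovered (b w : ℂ) (S : Finset (Finset ℂ)) (B : Finset ℂ) : Prop :=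
  ∀ D ∈ S, D ≠ B →
    ¬ (leftSlope b w D < rightSlope b w B ∧ rightSlope b w B < rightSlope b w D)

variable {b w : ℂ} {P Q A B D : Finset ℂ} {S : Finset (Finset ℂ)}

theorem disjoint_of_disjoint_hull
    (h : Disjoint (convexHull ℝ (A : Set ℂ)) (convexHull ℝ (B : Set ℂ))) : Disjoint A B := by
  rw [← Finset.disjoint_coe]
  exact h.mono (subset_convexHull ℝ _) (subset_convexHull ℝ _)

theorem IsNCFamily.subset (h : IsNCFamily P S) (hB : B ∈ S) : B ⊆ P :=
  fun x hx => (h.mem_iff x).2 ⟨B, hB, hx⟩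

theorem IsNCFamily.eq_of_mem (h : IsNCFamily P S) (hA : A ∈ S) (hB : B ∈ S) {x : ℂ}
    (hxA : x ∈ A) (hxB : x ∈ B) : A = B := by
  by_contra hne
  exact Finset.disjoint_left.1 (disjoint_of_disjoint_hull (h.disj A hA B hB hne)) hxA hxB

theorem GeneralPosition.mono (h : GeneralPosition P) (hA : A ⊆ P) : GeneralPosition A :=
  fun a ha b hb c hc => h a (hA ha) b (hA hb) c (hA hc)

theorem TriangleCondition.mono (h : TriangleCondition P) (hA : A ⊆ P) : TriangleCondition A :=
  fun a ha b hb c hc h1 h2 h3 x hx y hy =>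
    h a (hA ha) b (hA hb) c (hA hc) h1 h2 h3 x (hA hx) y (hA hy)

/-- From a point of largest norm the other points are seen in an open half-plane. -/
theorem exists_isView (hP : GeneralPosition P) (hne : P.Nonempty) :
    ∃ b ∈ P, ∃ w, IsView b w (P.erase b) := by
  obtain ⟨b, hb, hmax⟩ := P.exists_max_image (fun x => ‖x‖) hne
  by_cases hb0 : b = 0
  · refine ⟨b, hb, 1, one_ne_zero, ?_, ?_⟩
    · intro x hx
      have h1 := hmax x (Finset.mem_of_mem_erase hx)
      rw [hb0, norm_zero] at h1
      exact absurd ((norm_le_zero_iff.1 h1).trans hb0.symm) (Finset.ne_of_mem_erase hx)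
    · intro x hx
      have h1 := hmax x (Finset.mem_of_mem_erase hx)
      rw [hb0, norm_zero] at h1
      exact absurd ((norm_le_zero_iff.1 h1).trans hb0.symm) (Finset.ne_of_mem_erase hx)
  -- This factor turns the direction from b to the origin into the positive real axis. Positivity
  -- below says Re(conj(b) x) < |b|², which follows from |x| ≤ |b| and x ≠ b.
  have hw : -(starRingEnd ℂ) b ≠ 0 := by simpa using hb0
  have hpos : ∀ x ∈ P.erase b, 0 < (viewCoord b (-(starRingEnd ℂ) b) x).re := by
    intro x hx
    have h1 := hmax x (Finset.mem_of_mem_erase hx)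
    have h2 : ‖x‖ ^ 2 ≤ ‖b‖ ^ 2 := by gcongr
    rw [Complex.sq_norm, Complex.sq_norm, Complex.normSq_apply, Complex.normSq_apply] at h2
    have hne := Finset.ne_of_mem_erase hx
    have h3 : 0 < (x.re - b.re) ^ 2 + (x.im - b.im) ^ 2 := by
      by_contra! h
      apply hne
      have e1 : (x.re - b.re) ^ 2 = 0 := by
        linarith [sq_nonneg (x.re - b.re), sq_nonneg (x.im - b.im)]
      have e2 : (x.im - b.im) ^ 2 = 0 := by
        linarith [sq_nonneg (x.re - b.re), sq_nonneg (x.im - b.im)]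
      exact Complex.ext (by simpa [sub_eq_zero] using e1) (by simpa [sub_eq_zero] using e2)
    simp only [viewCoord, Complex.mul_re, Complex.neg_re, Complex.neg_im, Complex.conj_re,
      Complex.conj_im, Complex.sub_re, Complex.sub_im]
    nlinarith
  refine ⟨b, hb, _, hw, hpos, ?_⟩
  intro x hx y hy hxy
  by_contra hne
  refine hP b hb x (Finset.mem_of_mem_erase hx) y (Finset.mem_of_mem_erase hy)
    (Finset.ne_of_mem_erase hx).symm (Finset.ne_of_mem_erase hy).symm hne ?_
  have h := viewCoord_eq_of_slope_eq (hpos x hx) (hpos y hy) hxy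
  rw [collinear_iff_of_mem (p₀ := b) (by simp)]
  refine ⟨y - b, ?_⟩
  rintro p (rfl | rfl | rfl)
  · exact ⟨0, by simp⟩
  · refine ⟨(viewCoord b (-(starRingEnd ℂ) b) p).re / (viewCoord b (-(starRingEnd ℂ) b) y).re, ?_⟩
    set τ := (viewCoord b (-(starRingEnd ℂ) b) p).re / (viewCoord b (-(starRingEnd ℂ) b) y).re
    simp only [viewCoord, vadd_eq_add, Complex.real_smul] at h ⊢
    apply mul_left_cancel₀ hw
    linear_combination h
  · exact ⟨1, by simp⟩

theorem InFront.mono {A' D' : Finset ℂ} (h : InFront b A D) (hA : A ⊆ A') (hD : D ⊆ D') :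
    InFront b A' D' :=
  Set.Nonempty.mono (Set.inter_subset_inter (convexHull_mono (by exact_mod_cast hA))
    (convexHull_mono (by exact_mod_cast Finset.insert_subset_insert b hD))) h

open Classical in
-- Each block becomes its slope interval. The family is not required to cover Q, so that the blocks
-- on one side of a split can be treated as well.
theorem card_visible_eq_card_isUncovered (hv : IsView b w Q)
    (hT : TriangleCondition (insert b Q))
    (hne : ∀ B ∈ S, B.Nonempty) (hsub : ∀ B ∈ S, B ⊆ Q)
    (hdisj : ∀ A ∈ S, ∀ B ∈ S, A ≠ B →
      Disjoint (convexHull ℝ (A : Set ℂ)) (convexHull ℝ (B : Set ℂ))) :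
    (S.filter (IsVisible b S)).card = (S.filter (IsUncovered b w S)).card := by
  have hvS : ∀ B ∈ S, IsView b w B := fun B hB => hv.mono (hsub B hB)
  have hslope : ∀ A ∈ S, ∀ B ∈ S, A ≠ B → ∀ x ∈ A, ∀ y ∈ B, slope b w x ≠ slope b w y := by
    intro A hA B hB hAB x hx y hy h
    have := hv.inj x (hsub A hA hx) y (hsub B hB hy) h
    exact Finset.disjoint_left.1 (disjoint_of_disjoint_hull (hdisj A hA B hB hAB)) hx (this ▸ hy)
  refine Eq.trans ?_ ((card_visible_eq_card_uncovered (InFront b) (leftSlope b w)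
    (rightSlope b w) S (fun i hi => leftSlope_le_rightSlope (hne i hi)) ?_ ?_ ?_ ?_ ?_ ?_ ?_).trans
      ?_)
  · unfold IsVisible
    congr!
  · intro i hi j hj hij h
    obtain ⟨x, hx, hx'⟩ := exists_rightSlope (b := b) (w := w) (hne i hi)
    obtain ⟨y, hy, hy'⟩ := exists_rightSlope (b := b) (w := w) (hne j hj)
    exact hslope i hi j hj hij x hx y hy (hx'.trans (h.trans hy'.symm))
  · intro i hi j hj hij h
    obtain ⟨x, hx, hx'⟩ := exists_leftSlope (b := b) (w := w) (hne i hi)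
    obtain ⟨y, hy, hy'⟩ := exists_rightSlope (b := b) (w := w) (hne j hj)
    exact hslope i hi j hj hij x hx y hy (hx'.trans (h.trans hy'.symm))
  · intro i hi j hj _ h1 h2
    exact inFront_or_inFront (hvS i hi) (hvS j hj) (hne i hi) (hne j hj) h1 h2
  · intro i hi j hj _ h
    exact h.overlap (hvS i hi) (hvS j hj) (hne j hj)
  · intro i hi j hj hij h
    exact h.asymm (hvS i hi) (hvS j hj) (hne i hi) (hne j hj) (hdisj i hi j hj hij)
  · intro i hi j hj k hk hij hjk _ t h1 h2 h3 h4 h5 h6 h7 h8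
    exact InFront.trans_of_common_slope (hvS i hi) (hvS j hj) (hvS k hk) (hne i hi) (hne j hj)
      (hne k hk) (hdisj i hi j hj hij) (hdisj j hj k hk hjk) h7 h8 h1 h2 h3 h4 h5 h6
  · intro i hi j hj k hk hij hkj hik hFij hFkj h1 h2 h3 h4
    -- With p and q the extreme points of j, the end a of i and the end e of k would be two points
    -- inside the triangle b, p, q.
    obtain ⟨p, hp, hp'⟩ := exists_leftSlope (b := b) (w := w) (hne j hj)
    obtain ⟨q, hq, hq'⟩ := exists_rightSlope (b := b) (w := w) (hne j hj)
    obtain ⟨a, ha, ha'⟩ := exists_rightSlope (b := b) (w := w) (hne i hi)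
    obtain ⟨e, he, he'⟩ := exists_leftSlope (b := b) (w := w) (hne k hk)
    have hseg : segment ℝ p q ⊆ convexHull ℝ (j : Set ℂ) :=
      segment_subset_convexHull (by exact_mod_cast hp) (by exact_mod_cast hq)
    have hin : ∀ c ∈ S, c ≠ j → InFront b c j → ∀ x ∈ c, slope b w p < slope b w x →
        slope b w x < slope b w q → x ∈ interior (convexHull ℝ ({b, p, q} : Set ℂ)) := by
      intro c hc hcj hF x hx hx1 hx2
      exact mem_interior_triangle hv.ne_zero ((hvS j hj).pos p hp) ((hvS j hj).pos q hq)
        ((hvS c hc).pos x hx) hx1 hx2 fun y hy hxy =>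
          hF.re_lt (hvS c hc) (hvS j hj) (hne c hc) (hne j hj) (hdisj c hc j hj hcj)
            (subset_convexHull ℝ _ (by exact_mod_cast hx)) (hseg hy) hxy
    have hbne : ∀ x ∈ j, b ≠ x := by
      rintro x hx rfl
      have := (hvS j hj).pos _ hx
      simp [viewCoord_self] at this
    have hpq : p ≠ q := by
      rintro rfl
      linarith
    have hmem : ∀ c ∈ S, ∀ x ∈ c, x ∈ insert b Q := fun c hc x hx =>
      Finset.mem_insert_of_mem (hsub c hc hx)
    have := hT b (Finset.mem_insert_self b Q) p (hmem j hj p hp) q (hmem j hj q hq) (hbne p hp)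
      (hbne q hq) hpq a (hmem i hi a ha) e (hmem k hk e he)
      (hin i hi hij hFij a ha (by rw [hp', ha']; exact h1) (by rw [ha', hq']; exact h2))
      (hin k hk hkj hFkj e he (by rw [hp', he']; exact h3) (by rw [he', hq']; exact h4))
    exact Finset.disjoint_left.1 (disjoint_of_disjoint_hull (hdisj i hi k hk hik)) ha (this ▸ he)
  · unfold IsUncovered
    congr!

/-! ### Rays from b that separate the blocks -/

noncomputable def lowerPart (b w : ℂ) (Q : Finset ℂ) (q : ℂ) : Finset ℂ :=
  Q.filter fun x => slope b w x ≤ slope b w q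

noncomputable def upperPart (b w : ℂ) (Q : Finset ℂ) (q : ℂ) : Finset ℂ :=
  Q.filter fun x => slope b w q < slope b w x

theorem mem_lowerPart {q x : ℂ} :
    x ∈ lowerPart b w Q q ↔ x ∈ Q ∧ slope b w x ≤ slope b w q := Finset.mem_filter

theorem mem_upperPart {q x : ℂ} :
    x ∈ upperPart b w Q q ↔ x ∈ Q ∧ slope b w q < slope b w x := Finset.mem_filter

theorem lowerPart_subset (q : ℂ) : lowerPart b w Q q ⊆ Q := Finset.filter_subset _ _

theorem upperPart_subset (q : ℂ) : upperPart b w Q q ⊆ Q := Finset.filter_subset _ _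

/-- The ray from `b` through `q`, pushed slightly upwards, misses the hulls of all blocks. -/
def IsCut (b w : ℂ) (Q : Finset ℂ) (S : Finset (Finset ℂ)) (q : ℂ) : Prop :=
  ∀ B ∈ S, B ⊆ lowerPart b w Q q ∨ B ⊆ upperPart b w Q q

open Classical in
-- An uncovered block corresponds to its point of largest slope.
theorem card_isUncovered_eq_card_isCut (hv : IsView b w Q) (hS : IsNCFamily Q S) :
    (S.filter (IsUncovered b w S)).card = (Q.filter (IsCut b w Q S)).card := by
  have hex : ∀ B ∈ S.filter (IsUncovered b w S), ∃ x ∈ B, slope b w x = rightSlope b w B :=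
    fun B hB => exists_rightSlope (hS.nonempty B (Finset.mem_filter.1 hB).1)
  refine Finset.card_bij (fun B hB => (hex B hB).choose) ?_ ?_ ?_
  · intro B hB
    obtain ⟨hx, hx'⟩ := (hex B hB).choose_spec
    set x := (hex B hB).choose
    obtain ⟨hBS, hB'⟩ := Finset.mem_filter.1 hB
    refine Finset.mem_filter.2 ⟨hS.subset hBS hx, fun D hD => ?_⟩
    by_cases hDB : D = B
    · subst hDB
      exact Or.inl fun y hy => mem_lowerPart.2 ⟨hS.subset hD hy, hx' ▸ le_rightSlope hy⟩
    · rcases not_and_or.1 (hB' D hD hDB) with h | h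
      · refine Or.inr fun y hy => mem_upperPart.2 ⟨hS.subset hD hy, ?_⟩
        rw [hx']
        refine lt_of_le_of_ne ((not_lt.1 h).trans (leftSlope_le hy)) fun he => hDB ?_
        have := hv.inj x (hS.subset hBS hx) y (hS.subset hD hy) (hx'.trans he)
        exact hS.eq_of_mem hD hBS (this ▸ hy) hx
      · refine Or.inl fun y hy => mem_lowerPart.2 ⟨hS.subset hD hy, ?_⟩
        rw [hx']
        exact (le_rightSlope hy).trans (not_lt.1 h)
  · intro B hB D hD h
    have h1 := (hex B hB).choose_spec.1
    have h2 := (hex D hD).choose_spec.1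
    rw [h] at h1
    exact hS.eq_of_mem (Finset.mem_filter.1 hB).1 (Finset.mem_filter.1 hD).1 h1 h2
  · intro q hq
    obtain ⟨hqQ, hcut⟩ := Finset.mem_filter.1 hq
    obtain ⟨B, hB, hqB⟩ := (hS.mem_iff q).1 hqQ
    have hBl : B ⊆ lowerPart b w Q q := by
      rcases hcut B hB with h | h
      · exact h
      · exact absurd (mem_upperPart.1 (h hqB)).2 (lt_irrefl _)
    have hr : rightSlope b w B = slope b w q := by
      obtain ⟨y, hy, hy'⟩ := exists_rightSlope (b := b) (w := w) (hS.nonempty B hB)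
      exact le_antisymm (hy' ▸ (mem_lowerPart.1 (hBl hy)).2) (le_rightSlope hqB)
    have hBu : B ∈ S.filter (IsUncovered b w S) := by
      refine Finset.mem_filter.2 ⟨hB, fun D hD hDB => ?_⟩
      rw [hr]
      rintro ⟨h1, h2⟩
      rcases hcut D hD with h | h
      · obtain ⟨y, hy, hy'⟩ := exists_rightSlope (b := b) (w := w) (hS.nonempty D hD)
        have := (mem_lowerPart.1 (h hy)).2
        linarith
      · obtain ⟨y, hy, hy'⟩ := exists_leftSlope (b := b) (w := w) (hS.nonempty D hD)
        have := (mem_upperPart.1 (h hy)).2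
        linarith
    refine ⟨B, hBu, ?_⟩
    obtain ⟨hx, hx'⟩ := (hex B hBu).choose_spec
    exact hv.inj _ (hS.subset hB hx) q hqQ (hx'.trans hr)

theorem not_inFront_lower_upper (hv : IsView b w Q) {q : ℂ} {A D : Finset ℂ}
    (hA : A ⊆ lowerPart b w Q q) (hD : D ⊆ upperPart b w Q q) (hA' : A.Nonempty)
    (hD' : D.Nonempty) : ¬ InFront b A D ∧ ¬ InFront b D A := by
  have hvA := hv.mono (hA.trans (lowerPart_subset q))
  have hvD := hv.mono (hD.trans (upperPart_subset q))
  obtain ⟨x, hx, hx'⟩ := exists_rightSlope (b := b) (w := w) hA'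
  obtain ⟨y, hy, hy'⟩ := exists_leftSlope (b := b) (w := w) hD'
  have h1 := (mem_lowerPart.1 (hA hx)).2
  have h2 := (mem_upperPart.1 (hD hy)).2
  constructor
  · intro h
    linarith [(h.overlap hvA hvD hD').2]
  · intro h
    linarith [(h.overlap hvD hvA hA').1]

theorem disjoint_hull_of_not_inFront (h : ¬ InFront b A D) :
    Disjoint (convexHull ℝ (A : Set ℂ)) (convexHull ℝ (D : Set ℂ)) := by
  rw [Set.disjoint_iff_inter_eq_empty]
  by_contra h'
  exact h ((Set.nonempty_iff_ne_empty.2 h').mono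
    (Set.inter_subset_inter_right _ (convexHull_mono (by simp))))

theorem not_inFront_iff :
    ¬ InFront b A D ↔ Disjoint (convexHull ℝ (A : Set ℂ))
      (convexHull ℝ ((insert b D : Finset ℂ) : Set ℂ)) := by
  rw [Set.disjoint_iff_inter_eq_empty, InFront, Set.not_nonempty_iff_eq_empty]

theorem IsView.notMem_hull (hv : IsView b w A) : b ∉ convexHull ℝ (A : Set ℂ) := by
  intro h
  have := (slope_mem_of_mem_hull hv h).1
  simp [viewCoord_self] at this

theorem IsView.notMem (hv : IsView b w Q) : b ∉ Q := fun h =>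
  hv.notMem_hull (subset_convexHull ℝ _ (by exact_mod_cast h))

end PlanarNC

/-! ### Narayana polynomials and their coefficients -/

namespace PlanarNC
open Polynomial

/-- The rank generating polynomials, counted by blocks, of the noncrossing partitions. -/
noncomputable def narayanaPoly : ℕ → ℚ[X]
  | 0 => 1
  | n + 1 => X * narayanaPoly n +
      ∑ i : Fin n, narayanaPoly (i + 1) * narayanaPoly (n - 1 - i)

theorem narayanaPoly_succ (n : ℕ) : narayanaPoly (n + 1) = X * narayanaPoly n +
    ∑ i ∈ Finset.range n, narayanaPoly (i + 1) * narayanaPoly (n - 1 - i) := by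
  rw [narayanaPoly, Finset.sum_range (fun i => narayanaPoly (i + 1) * narayanaPoly (n - 1 - i))]

/-- The full convolution has one extra term, `narayanaPoly 0 * narayanaPoly n`, which X - 1 in place
of X compensates. This form translates directly into a generating function. -/
theorem narayanaPoly_succ' (n : ℕ) : narayanaPoly (n + 1) = (X - 1) * narayanaPoly n +
    ∑ p ∈ Finset.HasAntidiagonal.antidiagonal n, narayanaPoly p.1 * narayanaPoly p.2 := by
  rw [narayanaPoly_succ, Finset.Nat.sum_antidiagonal_eq_sum_range_succ
    (fun i j => narayanaPoly i * narayanaPoly j), Finset.sum_range_succ']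
  have h0 : narayanaPoly 0 = 1 := by rw [narayanaPoly]
  have : ∀ i ∈ Finset.range n, narayanaPoly (i + 1) * narayanaPoly (n - 1 - i) =
      narayanaPoly (i + 1) * narayanaPoly (n - (i + 1)) := by
    intro i _
    rw [show n - 1 - i = n - (i + 1) by omega]
  rw [Finset.sum_congr rfl this, h0]
  simp only [Nat.sub_zero]
  ring

theorem eval_one_narayanaPoly (n : ℕ) : (narayanaPoly n).eval 1 = catalan n := by
  induction n using Nat.strong_induction_on with
  | _ n ih =>
    cases n with
    | zero => simp [narayanaPoly]
    | succ n =>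
      rw [narayanaPoly_succ', catalan_succ', eval_add, eval_mul, eval_finsetSum]
      simp only [eval_sub, eval_X, eval_one, sub_self, zero_mul, zero_add, eval_mul]
      push_cast
      refine Finset.sum_congr rfl fun p hp => ?_
      have := Finset.HasAntidiagonal.mem_antidiagonal.1 hp
      rw [ih p.1 (by omega), ih p.2 (by omega)]

/-- The convolution recursion of the Narayana polynomials implies a three-term recurrence. -/
theorem three_term_of_convolution {R : Type*} [CommRing R] [IsDomain R] [CharZero R] (x : R)
    (f : ℕ → R) (h0 : f 0 = 1) (hf : ∀ n, f (n + 1) = (x - 1) * f n +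
      ∑ p ∈ Finset.HasAntidiagonal.antidiagonal n, f p.1 * f p.2) (n : ℕ) :
    ((n : R) + 3) * f (n + 2) =
      (2 * n + 3) * ((1 + x) * f (n + 1)) - n * ((1 - x) ^ 2 * f n) := by
  set F : PowerSeries R := PowerSeries.mk f with hF
  set z : PowerSeries R := PowerSeries.X with hz
  set c : PowerSeries R := PowerSeries.C (x - 1) with hc
  set s : PowerSeries R := PowerSeries.C (2 * (1 + x)) with hs
  set e : PowerSeries R := PowerSeries.C ((1 - x) ^ 2) with he
  -- Completing the square in the quadratic equation of F: Y is a square root of the discriminant Δ.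
  set Y := 1 - z * (c + PowerSeries.C 2 * F) with hY
  set Δ := 1 - z * s + z * (z * e) with hΔ
  have hFeq : F = 1 + z * (c * F + F * F) := by
    ext1 m
    cases m with
    | zero => simp [hF, h0, hz]
    | succ m =>
      rw [map_add, hz, PowerSeries.coeff_succ_X_mul, map_add, hc, PowerSeries.coeff_C_mul,
        PowerSeries.coeff_mul, hF]
      simp only [PowerSeries.coeff_mk]
      rw [hf]
      simp [PowerSeries.coeff_one]
  have hC0 : PowerSeries.C (2 : R) = 2 := map_ofNat _ 2
  have hC1 : s = 2 * (c + 2) := by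
    rw [hs, hc, ← hC0, ← map_add, ← map_mul]
    congr 1; ring
  have hC2 : e = c * c := by
    rw [he, hc, ← map_mul]
    congr 1; ring
  have hsq : Y * Y = Δ := by
    rw [hY, hΔ, hC1, hC2, hC0]
    linear_combination (-4 * z) * hFeq
  let d := PowerSeries.derivative R
  -- Differentiating Y² = Δ and multiplying by Y gives a linear differential equation, whose
  -- coefficients are the recurrence.
  have hd : 2 * (Δ * d Y) = d Δ * Y := by
    rw [← hsq, Derivation.leibniz, smul_eq_mul]
    ring
  have hdz : d z = 1 := PowerSeries.derivative_X
  have hdC : ∀ a : R, d (PowerSeries.C a) = 0 := fun a => PowerSeries.derivative_C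
  have hdΔ : d Δ = z * (PowerSeries.C 2 * e) - s := by
    rw [hΔ, map_add, map_sub, Derivation.leibniz, Derivation.leibniz, Derivation.leibniz, hdz,
      hs, he, hdC, hdC, hC0]
    simp only [d, PowerSeries.derivative_one, smul_eq_mul]
    ring
  have hd' : PowerSeries.C 2 * d Y - z * (PowerSeries.C 2 * (s * d Y)) +
      z * (z * (PowerSeries.C 2 * (e * d Y))) = z * (PowerSeries.C 2 * (e * Y)) - s * Y := by
    have : 2 * (Δ * d Y) = (z * (PowerSeries.C 2 * e) - s) * Y := by rw [hd, hdΔ]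
    rw [hΔ] at this
    rw [hC0] at this ⊢
    linear_combination this
  have h2 := congrArg (PowerSeries.coeff (n + 2)) hd'
  simp only [hz, hs, he, d, map_add, map_sub, PowerSeries.coeff_succ_X_mul,
    PowerSeries.coeff_C_mul, PowerSeries.coeff_derivative] at h2
  have hy : ∀ m, PowerSeries.coeff (m + 2) Y = -(2 * f (m + 1)) := by
    intro m
    rw [hY, map_sub, hz, PowerSeries.coeff_succ_X_mul, map_add, PowerSeries.coeff_C_mul, hc, hF]
    simp [PowerSeries.coeff_one]
  -- The formula `hy` does not extend to the linear coefficient of Y, to which c contributes, but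
  -- there the factor n is 0.
  have hy1 : (n : R) * PowerSeries.coeff (n + 1) Y = n * -(2 * f n) := by
    cases n with
    | zero => simp
    | succ n => rw [hy]
  rw [hy, hy] at h2
  push_cast at h2
  have h4 : (4 : R) ≠ 0 := by norm_num
  apply mul_left_cancel₀ h4
  linear_combination -h2 + (2 * (1 - x) ^ 2) * hy1

theorem narayanaPoly_three_term (n : ℕ) :
    ((n : ℚ[X]) + (3 : ℚ[X])) * narayanaPoly (n + 2) =
      (2 * (n : ℚ[X]) + 3) * (((1 : ℚ[X]) + X) * narayanaPoly (n + 1)) -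
        (n : ℚ[X]) * (((1 : ℚ[X]) - X) ^ 2 * narayanaPoly n) :=
  three_term_of_convolution X narayanaPoly (by rw [narayanaPoly]) narayanaPoly_succ' n

theorem narayanaPoly_one : narayanaPoly 1 = X := by
  rw [narayanaPoly_succ, narayanaPoly]; simp

theorem choose_succ_mul (m k : ℕ) :
    (m.choose (k + 1) : ℚ) * (k + 1) = m.choose k * (m - k) := by
  rcases le_or_gt k m with h | h
  · have := Nat.choose_succ_right_eq m k
    have h' : (m.choose (k + 1) * (k + 1) : ℚ) = m.choose k * ((m - k : ℕ) : ℚ) := by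
      exact_mod_cast this
    rw [h', Nat.cast_sub h]
  · rw [Nat.choose_eq_zero_of_lt h, Nat.choose_eq_zero_of_lt (by omega)]; simp

theorem narayana_three_term (m k : ℕ) :
    ((m : ℚ) + 3) * narayana (m + 2) (k + 3) =
      (2 * m + 3) * (narayana (m + 1) (k + 3) + narayana (m + 1) (k + 2)) -
      m * (narayana m (k + 3) - 2 * narayana m (k + 2) + narayana m (k + 1)) := by
  have h1 := choose_succ_mul m k
  have h2 := choose_succ_mul m (k + 1)
  have h3 := choose_succ_mul m (k + 2)
  push_cast at h1 h2 h3
  have e1 : (m.choose (k + 1) : ℚ) = m.choose k * (m - k) / (k + 1) := by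
    rw [eq_div_iff (by positivity)]; exact h1
  have e2 : (m.choose (k + 2) : ℚ) = m.choose (k + 1) * (m - (k + 1)) / (k + 2) := by
    rw [eq_div_iff (by positivity)]; linarith
  have e3 : (m.choose (k + 3) : ℚ) = m.choose (k + 2) * (m - (k + 2)) / (k + 3) := by
    rw [eq_div_iff (by positivity)]; linarith
  have hm : (m : ℚ) * (narayana m (k + 3) - 2 * narayana m (k + 2) + narayana m (k + 1)) =
      m.choose (k + 3) * m.choose (k + 2) - 2 * (m.choose (k + 2) * m.choose (k + 1)) +
        m.choose (k + 1) * m.choose k := by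
    -- Clearing the denominator needs m ≠ 0; for m = 0 the factor m and the binomials of 0 vanish.
    rcases eq_or_ne m 0 with rfl | hm
    · simp
    · have : (m : ℚ) ≠ 0 := by exact_mod_cast hm
      simp only [narayana, Nat.add_sub_cancel, show k + 3 - 1 = k + 2 by omega,
        show k + 2 - 1 = k + 1 by omega]
      field_simp
  rw [hm]
  simp only [narayana, show k + 3 - 1 = k + 2 by omega, show k + 2 - 1 = k + 1 by omega]
  have c1 : ∀ j, ((m + 1).choose (j + 1) : ℚ) = m.choose j + m.choose (j + 1) := fun j => by
    rw [Nat.choose_succ_succ]; push_cast; rfl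
  have c2 : ∀ j, ((m + 2).choose (j + 1) : ℚ) =
      (m + 1).choose j + (m + 1).choose (j + 1) := fun j => by
    rw [Nat.choose_succ_succ]; push_cast; rfl
  rw [c2 (k + 2), c2 (k + 1), c1 (k + 2), c1 (k + 1), c1 k, e3, e2, e1]
  push_cast
  field_simp
  ring

theorem coeff_zero_narayanaPoly (n : ℕ) : (narayanaPoly (n + 1)).coeff 0 = 0 := by
  induction n using Nat.strong_induction_on with
  | _ n ih =>
    rw [narayanaPoly_succ, coeff_add, finsetSum_coeff, Polynomial.mul_coeff_zero, coeff_X_zero,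
      zero_mul, zero_add]
    refine Finset.sum_eq_zero fun i hi => ?_
    have := Finset.mem_range.1 hi
    rw [Polynomial.mul_coeff_zero, ih i this, zero_mul]

theorem coeff_narayanaPoly (n k : ℕ) :
    (narayanaPoly (n + 1)).coeff (k + 1) = narayana (n + 1) (k + 1) := by
  induction n using Nat.strong_induction_on generalizing k with
  | _ n ih =>
    rcases n with _ | _ | n
    · rw [zero_add, narayanaPoly_one, coeff_X, narayana]
      cases k
      · simp
      · simp [Nat.choose_eq_zero_of_lt]
    · rw [narayanaPoly_succ]
      simp only [Finset.sum_range_one, zero_add, narayanaPoly_one, narayana]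
      rw [narayanaPoly]
      rcases k with _ | _ | k
      · simp
      · simp [coeff_X]
      · simp [coeff_X, Nat.choose_eq_zero_of_lt]
    · have h := congrArg (fun p => coeff p (k + 1)) (narayanaPoly_three_term (n + 1))
      have h2 : (C 2 : ℚ[X]) = 2 := map_ofNat _ 2
      have h3 : (C 3 : ℚ[X]) = 3 := map_ofNat _ 3
      have e1 : (((n + 1 : ℕ) : ℚ[X]) + 3) = C (((n + 1 : ℕ) : ℚ) + 3) := by
        rw [map_add, map_natCast, h3]
      have e2 : (2 * ((n + 1 : ℕ) : ℚ[X]) + 3) = C (2 * ((n + 1 : ℕ) : ℚ) + 3) := by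
        rw [map_add, map_mul, map_natCast, h3, h2]
      have e3 : ((n + 1 : ℕ) : ℚ[X]) = C ((n + 1 : ℕ) : ℚ) := by simp
      have e4 : ((1 - X) ^ 2 * narayanaPoly (n + 1) : ℚ[X]) = narayanaPoly (n + 1) -
          C 2 * (X * narayanaPoly (n + 1)) + X * (X * narayanaPoly (n + 1)) := by
        rw [h2]; ring
      rw [e1, e2, e3, e4, add_mul, one_mul] at h
      simp only [coeff_C_mul, coeff_sub, coeff_add, coeff_X_mul] at h
      rw [ih (n + 1) (by omega), ih n (by omega)] at h
      have hpos : ((n + 1 : ℕ) : ℚ) + 3 ≠ 0 := by positivity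
      apply mul_left_cancel₀ hpos
      rw [h]
      -- Multiplication by X and X² shifts the index, so the two lowest cases reach constant
      -- coefficients, which `ih` does not cover.
      rcases k with _ | _ | k
      · rw [coeff_zero_narayanaPoly, coeff_zero_narayanaPoly, mul_coeff_zero]
        simp [narayana]
        field_simp
        ring
      · rw [ih (n + 1) (by omega), ih n (by omega), coeff_X_mul, coeff_zero_narayanaPoly]
        simp only [narayana, zero_add, Nat.cast_choose_two, Nat.choose_one_right,
          Nat.choose_zero_right, Nat.sub_self, show 2 - 1 = 1 from rfl, show 1 + 1 = 2 from rfl]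
        push_cast
        field_simp
        ring
      · rw [coeff_X_mul, ih (n + 1) (by omega), ih n (by omega), ih n (by omega)]
        exact (narayana_three_term (n + 1) k).symm

end PlanarNC

/-! ### Recursion for the block polynomial on deleting an extreme point -/

namespace PlanarNC
open Polynomial

variable {b w : ℂ} {P Q A B D : Finset ℂ} {S T : Finset (Finset ℂ)}

open Classical in
noncomputable def ncFamilies (P : Finset ℂ) : Finset (Finset (Finset ℂ)) :=
  P.powerset.powerset.filter (IsNCFamily P)

open Classical in
theorem mem_ncFamilies : S ∈ ncFamilies P ↔ IsNCFamily P S := by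
  rw [ncFamilies, Finset.mem_filter]
  refine ⟨fun h => h.2, fun h => ⟨?_, h⟩⟩
  exact Finset.mem_powerset.2 fun B hB => Finset.mem_powerset.2 (h.subset hB)

/-- The generating polynomial of the noncrossing partitions of `P` by number of blocks. -/
noncomputable def ncPoly (P : Finset ℂ) : ℚ[X] := ∑ S ∈ ncFamilies P, X ^ S.card

theorem IsNCFamily.insert_singleton (hv : IsView b w Q) (hS : IsNCFamily Q S) :
    IsNCFamily (insert b Q) (insert {b} S) where
  nonempty B hB := by
    rcases Finset.mem_insert.1 hB with rfl | hB
    · exact Finset.singleton_nonempty b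
    · exact hS.nonempty B hB
  disj := by
    have key : ∀ B ∈ S, Disjoint (convexHull ℝ (({b} : Finset ℂ) : Set ℂ))
        (convexHull ℝ (B : Set ℂ)) := by
      intro B hB
      rw [Finset.coe_singleton, convexHull_singleton, Set.disjoint_singleton_left]
      exact (hv.mono (hS.subset hB)).notMem_hull
    intro A hA B hB hAB
    rcases Finset.mem_insert.1 hA with rfl | hA <;> rcases Finset.mem_insert.1 hB with rfl | hB
    · exact absurd rfl hAB
    · exact key B hB
    · exact (key A hA).symm
    · exact hS.disj A hA B hB hAB
  mem_iff x := by
    simp only [Finset.mem_insert, hS.mem_iff x, exists_eq_or_imp, Finset.mem_singleton]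

theorem IsNCFamily.erase_singleton (hb : b ∉ Q) (hS : IsNCFamily (insert b Q) S)
    (h : {b} ∈ S) : IsNCFamily Q (S.erase {b}) where
  nonempty B hB := hS.nonempty B (Finset.mem_of_mem_erase hB)
  disj A hA B hB := hS.disj A (Finset.mem_of_mem_erase hA) B (Finset.mem_of_mem_erase hB)
  mem_iff x := by
    constructor
    · intro hx
      obtain ⟨B, hB, hxB⟩ := (hS.mem_iff x).1 (Finset.mem_insert_of_mem hx)
      refine ⟨B, Finset.mem_erase.2 ⟨?_, hB⟩, hxB⟩
      rintro rfl
      exact hb (Finset.mem_singleton.1 hxB ▸ hx)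
    · rintro ⟨B, hB, hxB⟩
      obtain ⟨hne, hBS⟩ := Finset.mem_erase.1 hB
      rcases Finset.mem_insert.1 (hS.subset hBS hxB) with rfl | h'
      · exact absurd (hS.eq_of_mem hBS h hxB (Finset.mem_singleton_self x)) hne
      · exact h'

theorem IsNCFamily.join (hS : IsNCFamily Q S) (hB : B ∈ S) (hvis : IsVisible b S B) :
    IsNCFamily (insert b Q) (insert (insert b B) (S.erase B)) where
  nonempty A hA := by
    rcases Finset.mem_insert.1 hA with rfl | hA
    · exact Finset.insert_nonempty b B
    · exact hS.nonempty A (Finset.mem_of_mem_erase hA)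
  disj := by
    have key : ∀ A ∈ S.erase B, Disjoint (convexHull ℝ (A : Set ℂ))
        (convexHull ℝ ((insert b B : Finset ℂ) : Set ℂ)) := fun A hA =>
      not_inFront_iff.1 (hvis A (Finset.mem_of_mem_erase hA) (Finset.ne_of_mem_erase hA))
    intro A hA D hD hAD
    rcases Finset.mem_insert.1 hA with rfl | hA <;> rcases Finset.mem_insert.1 hD with rfl | hD
    · exact absurd rfl hAD
    · exact (key D hD).symm
    · exact key A hA
    · exact hS.disj A (Finset.mem_of_mem_erase hA) D (Finset.mem_of_mem_erase hD) hAD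
  mem_iff x := by
    rw [Finset.mem_insert, hS.mem_iff x]
    constructor
    · rintro (rfl | ⟨A, hA, hxA⟩)
      · exact ⟨_, Finset.mem_insert_self _ _, Finset.mem_insert_self _ _⟩
      · by_cases hAB : A = B
        · subst hAB
          exact ⟨_, Finset.mem_insert_self _ _, Finset.mem_insert_of_mem hxA⟩
        · exact ⟨A, Finset.mem_insert_of_mem (Finset.mem_erase.2 ⟨hAB, hA⟩), hxA⟩
    · rintro ⟨A, hA, hxA⟩
      rcases Finset.mem_insert.1 hA with rfl | hA
      · rcases Finset.mem_insert.1 hxA with rfl | hx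
        · exact Or.inl rfl
        · exact Or.inr ⟨B, hB, hx⟩
      · exact Or.inr ⟨A, Finset.mem_of_mem_erase hA, hxA⟩

theorem IsNCFamily.insert_notMem_erase (hb : b ∉ Q) (hS : IsNCFamily Q S) :
    insert b B ∉ S.erase B := fun h =>
  hb (hS.subset (Finset.mem_of_mem_erase h) (Finset.mem_insert_self b B))

theorem IsNCFamily.card_join (hb : b ∉ Q) (hS : IsNCFamily Q S) (hB : B ∈ S) :
    (insert (insert b B) (S.erase B)).card = S.card := by
  rw [Finset.card_insert_of_notMem (hS.insert_notMem_erase hb), Finset.card_erase_add_one hB]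

theorem IsNCFamily.singleton_notMem_join (hb : b ∉ Q) (hS : IsNCFamily Q S) (hB : B ∈ S) :
    {b} ∉ insert (insert b B) (S.erase B) := by
  intro h
  rcases Finset.mem_insert.1 h with h | h
  · obtain ⟨x, hx⟩ := hS.nonempty B hB
    have : x ∈ ({b} : Finset ℂ) := h ▸ Finset.mem_insert_of_mem hx
    exact hb (Finset.mem_singleton.1 this ▸ hS.subset hB hx)
  · exact hb (hS.subset (Finset.mem_of_mem_erase h) (Finset.mem_singleton_self b))

/-- Take b out of its block. What remains is visible because its hull with b is the hull of the
original block. -/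
theorem IsNCFamily.exists_join (hb : b ∉ Q) (hS : IsNCFamily (insert b Q) S)
    (h : {b} ∉ S) : ∃ T B, IsNCFamily Q T ∧ B ∈ T ∧ IsVisible b T B ∧
      insert (insert b B) (T.erase B) = S := by
  obtain ⟨C, hC, hbC⟩ := (hS.mem_iff b).1 (Finset.mem_insert_self b Q)
  have hCne : (C.erase b).Nonempty := by
    rw [Finset.nonempty_iff_ne_empty]
    intro he
    rcases Finset.erase_eq_empty_iff C b |>.1 he with rfl | rfl
    · simp at hbC
    · exact h hC
  have hnot : C.erase b ∉ S := by
    intro h'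
    obtain ⟨x, hx⟩ := hCne
    have := hS.eq_of_mem h' hC hx (Finset.mem_of_mem_erase hx)
    exact Finset.notMem_erase b C (this.symm ▸ hbC : b ∈ C.erase b)
  have hins : insert b (C.erase b) = C := Finset.insert_erase hbC
  have hdisjC : ∀ A ∈ S.erase C, Disjoint (convexHull ℝ (A : Set ℂ))
      (convexHull ℝ ((C : Finset ℂ) : Set ℂ)) := fun A hA =>
    hS.disj A (Finset.mem_of_mem_erase hA) C hC (Finset.ne_of_mem_erase hA)
  have hsubC : convexHull ℝ ((C.erase b : Finset ℂ) : Set ℂ) ⊆ convexHull ℝ (C : Set ℂ) :=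
    convexHull_mono (by exact_mod_cast Finset.erase_subset b C)
  refine ⟨insert (C.erase b) (S.erase C), C.erase b, ⟨?_, ?_, ?_⟩, Finset.mem_insert_self _ _,
    ?_, ?_⟩
  · intro A hA
    rcases Finset.mem_insert.1 hA with rfl | hA
    · exact hCne
    · exact hS.nonempty A (Finset.mem_of_mem_erase hA)
  · intro A hA D hD hAD
    rcases Finset.mem_insert.1 hA with rfl | hA <;> rcases Finset.mem_insert.1 hD with rfl | hD
    · exact absurd rfl hAD
    · exact (hdisjC D hD).symm.mono_left hsubC
    · exact (hdisjC A hA).mono_right hsubC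
    · exact hS.disj A (Finset.mem_of_mem_erase hA) D (Finset.mem_of_mem_erase hD) hAD
  · intro x
    constructor
    · intro hx
      obtain ⟨A, hA, hxA⟩ := (hS.mem_iff x).1 (Finset.mem_insert_of_mem hx)
      by_cases hAC : A = C
      · subst hAC
        refine ⟨_, Finset.mem_insert_self _ _, Finset.mem_erase.2 ⟨?_, hxA⟩⟩
        rintro rfl
        exact hb hx
      · exact ⟨A, Finset.mem_insert_of_mem (Finset.mem_erase.2 ⟨hAC, hA⟩), hxA⟩
    · rintro ⟨A, hA, hxA⟩
      have hx : x ∈ insert b Q ∧ x ≠ b := by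
        rcases Finset.mem_insert.1 hA with rfl | hA
        · exact ⟨hS.subset hC (Finset.mem_of_mem_erase hxA), Finset.ne_of_mem_erase hxA⟩
        · obtain ⟨hne, hAS⟩ := Finset.mem_erase.1 hA
          refine ⟨hS.subset hAS hxA, ?_⟩
          rintro rfl
          exact hne (hS.eq_of_mem hAS hC hxA hbC)
      exact (Finset.mem_insert.1 hx.1).resolve_left hx.2
  · intro A hA hne
    rw [not_inFront_iff, hins]
    exact hdisjC A ((Finset.mem_insert.1 hA).resolve_left hne)
  · rw [hins, Finset.erase_insert (fun h' => hnot (Finset.mem_of_mem_erase h')),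
      Finset.insert_erase hC]

theorem join_injective (hb : b ∉ Q) (hS : IsNCFamily Q S) (hT : IsNCFamily Q T) (hB : B ∈ S)
    (hD : D ∈ T)
    (h : insert (insert b B) (S.erase B) = insert (insert b D) (T.erase D)) :
    S = T ∧ B = D := by
  have hbB : b ∉ B := fun h => hb (hS.subset hB h)
  have hbD : b ∉ D := fun h => hb (hT.subset hD h)
  have h1 : insert b B = insert b D := by
    have : insert b B ∈ insert (insert b D) (T.erase D) := h ▸ Finset.mem_insert_self _ _
    refine (Finset.mem_insert.1 this).resolve_right fun h' => ?_
    exact hb (hT.subset (Finset.mem_of_mem_erase h') (Finset.mem_insert_self b B))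
  have h2 : B = D := by
    rw [← Finset.erase_insert hbB, h1, Finset.erase_insert hbD]
  refine ⟨?_, h2⟩
  subst h2
  have h3 := congrArg (fun U => U.erase (insert b B)) h
  simp only [Finset.erase_insert (hS.insert_notMem_erase hb),
    Finset.erase_insert (hT.insert_notMem_erase hb)] at h3
  rw [← Finset.insert_erase hB, h3, Finset.insert_erase hD]

open Classical in
theorem sum_singleton_mem (hv : IsView b w Q) :
    ∑ S ∈ (ncFamilies (insert b Q)).filter (fun S => {b} ∈ S), (X : ℚ[X]) ^ S.card =
      X * ncPoly Q := by
  rw [ncPoly, Finset.mul_sum]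
  have hnot : ∀ S ∈ ncFamilies Q, {b} ∉ S := fun S hS h =>
    hv.notMem ((mem_ncFamilies.1 hS).subset h (Finset.mem_singleton_self b))
  refine Finset.sum_bij' (fun S _ => S.erase {b}) (fun S _ => insert {b} S) ?_ ?_ ?_ ?_ ?_
  · intro S hS
    obtain ⟨h1, h2⟩ := Finset.mem_filter.1 hS
    exact mem_ncFamilies.2 ((mem_ncFamilies.1 h1).erase_singleton hv.notMem h2)
  · intro S hS
    exact Finset.mem_filter.2 ⟨mem_ncFamilies.2 ((mem_ncFamilies.1 hS).insert_singleton hv),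
      Finset.mem_insert_self _ _⟩
  · intro S hS
    exact Finset.insert_erase (Finset.mem_filter.1 hS).2
  · intro S hS
    exact Finset.erase_insert (hnot S hS)
  · intro S hS
    rw [← pow_succ', Finset.card_erase_add_one (Finset.mem_filter.1 hS).2]

open Classical in
theorem sum_singleton_notMem (hv : IsView b w Q) :
    ∑ S ∈ (ncFamilies (insert b Q)).filter (fun S => {b} ∉ S), (X : ℚ[X]) ^ S.card =
      ∑ S ∈ ncFamilies Q, ∑ _B ∈ S.filter (IsVisible b S), (X : ℚ[X]) ^ S.card := by
  rw [Finset.sum_sigma']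
  symm
  refine Finset.sum_bij (fun p _ => insert (insert b p.2) (p.1.erase p.2)) ?_ ?_ ?_ ?_
  · rintro ⟨S, B⟩ h
    obtain ⟨h1, h2⟩ := Finset.mem_sigma.1 h
    obtain ⟨h2, h3⟩ := Finset.mem_filter.1 h2
    have hS := mem_ncFamilies.1 h1
    exact Finset.mem_filter.2 ⟨mem_ncFamilies.2 (hS.join h2 h3),
      hS.singleton_notMem_join hv.notMem h2⟩
  · rintro ⟨S, B⟩ h ⟨T, D⟩ h' heq
    obtain ⟨h1, h2⟩ := Finset.mem_sigma.1 h
    obtain ⟨h1', h2'⟩ := Finset.mem_sigma.1 h'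
    obtain ⟨rfl, rfl⟩ := join_injective hv.notMem (mem_ncFamilies.1 h1) (mem_ncFamilies.1 h1')
      (Finset.mem_filter.1 h2).1 (Finset.mem_filter.1 h2').1 heq
    rfl
  · intro S hS
    obtain ⟨h1, h2⟩ := Finset.mem_filter.1 hS
    obtain ⟨T, B, hT, hB, hvis, h⟩ := (mem_ncFamilies.1 h1).exists_join hv.notMem h2
    exact ⟨⟨T, B⟩, Finset.mem_sigma.2 ⟨mem_ncFamilies.2 hT, Finset.mem_filter.2 ⟨hB, hvis⟩⟩, h⟩
  · rintro ⟨S, B⟩ h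
    obtain ⟨h1, h2⟩ := Finset.mem_sigma.1 h
    rw [(mem_ncFamilies.1 h1).card_join hv.notMem (Finset.mem_filter.1 h2).1]

theorem IsNCFamily.restrict (hS : IsNCFamily Q S) (hAQ : A ⊆ Q)
    (h : ∀ B ∈ S, B ⊆ A ∨ Disjoint B A) [DecidablePred fun B : Finset ℂ => B ⊆ A] :
    IsNCFamily A (S.filter fun B => B ⊆ A) where
  nonempty B hB := hS.nonempty B (Finset.mem_filter.1 hB).1
  disj B hB D hD := hS.disj B (Finset.mem_filter.1 hB).1 D (Finset.mem_filter.1 hD).1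
  mem_iff x := by
    constructor
    · intro hx
      obtain ⟨B, hB, hxB⟩ := (hS.mem_iff x).1 (hAQ hx)
      refine ⟨B, Finset.mem_filter.2 ⟨hB, (h B hB).resolve_right fun h' => ?_⟩, hxB⟩
      exact Finset.disjoint_left.1 h' hxB hx
    · rintro ⟨B, hB, hxB⟩
      exact (Finset.mem_filter.1 hB).2 hxB

theorem disjoint_lowerPart_upperPart (q : ℂ) :
    Disjoint (lowerPart b w Q q) (upperPart b w Q q) := by
  rw [Finset.disjoint_left]
  intro x h1 h2
  exact absurd (mem_lowerPart.1 h1).2 (not_le.2 (mem_upperPart.1 h2).2)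

theorem IsNCFamily.union (hv : IsView b w Q) {q : ℂ}
    (hS : IsNCFamily (lowerPart b w Q q) S) (hT : IsNCFamily (upperPart b w Q q) T) :
    IsNCFamily Q (S ∪ T) where
  nonempty B hB := (Finset.mem_union.1 hB).elim (hS.nonempty B) (hT.nonempty B)
  disj := by
    have key : ∀ A ∈ S, ∀ B ∈ T, Disjoint (convexHull ℝ (A : Set ℂ)) (convexHull ℝ (B : Set ℂ)) :=
      fun A hA B hB => disjoint_hull_of_not_inFront (not_inFront_lower_upper hv (hS.subset hA)
        (hT.subset hB) (hS.nonempty A hA) (hT.nonempty B hB)).1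
    intro A hA B hB hAB
    rcases Finset.mem_union.1 hA with hA | hA <;> rcases Finset.mem_union.1 hB with hB | hB
    · exact hS.disj A hA B hB hAB
    · exact key A hA B hB
    · exact (key B hB A hA).symm
    · exact hT.disj A hA B hB hAB
  mem_iff x := by
    have : x ∈ Q ↔ x ∈ lowerPart b w Q q ∨ x ∈ upperPart b w Q q := by
      rw [mem_lowerPart, mem_upperPart, ← and_or_left]
      simp [le_or_gt]
    rw [this, hS.mem_iff, hT.mem_iff]
    simp only [Finset.mem_union, or_and_right, exists_or]

open Classical in
-- Blocks on different sides of the ray have disjoint slope ranges and so never cross: the two sides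
-- can be partitioned independently.
theorem sum_isCut (hv : IsView b w Q) (q : ℂ) :
    ∑ S ∈ (ncFamilies Q).filter (fun S => IsCut b w Q S q), (X : ℚ[X]) ^ S.card =
      ncPoly (lowerPart b w Q q) * ncPoly (upperPart b w Q q) := by
  rw [ncPoly, ncPoly, Finset.sum_mul_sum, ← Finset.sum_product']
  set L := lowerPart b w Q q
  set U := upperPart b w Q q
  have hLU : Disjoint L U := disjoint_lowerPart_upperPart q
  have hnot : ∀ B : Finset ℂ, B.Nonempty → B ⊆ L → ¬ B ⊆ U := fun B ⟨x, hx⟩ h1 h2 =>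
    Finset.disjoint_left.1 hLU (h1 hx) (h2 hx)
  refine Finset.sum_bij' (fun S _ => (S.filter (· ⊆ L), S.filter (· ⊆ U)))
    (fun p _ => p.1 ∪ p.2) ?_ ?_ ?_ ?_ ?_
  · intro S hS
    obtain ⟨h1, h2⟩ := Finset.mem_filter.1 hS
    have h1 := mem_ncFamilies.1 h1
    refine Finset.mem_product.2 ⟨mem_ncFamilies.2 (h1.restrict (lowerPart_subset q) ?_),
      mem_ncFamilies.2 (h1.restrict (upperPart_subset q) ?_)⟩
    · exact fun B hB => (h2 B hB).imp_right fun h => (hLU.mono_right h).symm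
    · exact fun B hB => (h2 B hB).symm.imp_right fun h => hLU.mono_left h
  · rintro ⟨S, T⟩ h
    obtain ⟨h1, h2⟩ := Finset.mem_product.1 h
    have h1 := mem_ncFamilies.1 h1
    have h2 := mem_ncFamilies.1 h2
    exact Finset.mem_filter.2 ⟨mem_ncFamilies.2 (h1.union hv h2), fun B hB =>
      (Finset.mem_union.1 hB).imp h1.subset h2.subset⟩
  · intro S hS
    obtain ⟨h1, h2⟩ := Finset.mem_filter.1 hS
    rw [← Finset.filter_or]
    exact Finset.filter_true_of_mem h2
  · rintro ⟨S, T⟩ h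
    obtain ⟨h1, h2⟩ := Finset.mem_product.1 h
    have h1 := mem_ncFamilies.1 h1
    have h2 := mem_ncFamilies.1 h2
    simp only [Finset.filter_union, Prod.mk.injEq]
    rw [Finset.filter_true_of_mem (fun B hB => h1.subset hB),
      Finset.filter_true_of_mem (fun B hB => h2.subset hB),
      Finset.filter_false_of_mem (fun B hB h' => hnot B (h2.nonempty B hB) h' (h2.subset hB)),
      Finset.filter_false_of_mem (fun B hB => hnot B (h1.nonempty B hB) (h1.subset hB))]
    simp
  · intro S hS
    obtain ⟨h1, h2⟩ := Finset.mem_filter.1 hS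
    have h1 := mem_ncFamilies.1 h1
    rw [← pow_add, ← Finset.card_union_of_disjoint, ← Finset.filter_or,
      Finset.filter_true_of_mem h2]
    exact Finset.disjoint_filter.2 fun B hB => hnot B (h1.nonempty B hB)

/-- The visible blocks of each family are replaced by its cuts, equal in number, and then the sums
over families and over q are exchanged. -/
theorem ncPoly_insert (hv : IsView b w Q) (hT : TriangleCondition (insert b Q)) :
    ncPoly (insert b Q) = X * ncPoly Q +
      ∑ q ∈ Q, ncPoly (lowerPart b w Q q) * ncPoly (upperPart b w Q q) := by
  classical
  rw [ncPoly, ← Finset.sum_filter_add_sum_filter_not _ (fun S => {b} ∈ S), sum_singleton_mem hv,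
    sum_singleton_notMem hv]
  congr 1
  have h1 : ∀ S ∈ ncFamilies Q, ∑ _B ∈ S.filter (IsVisible b S), (X : ℚ[X]) ^ S.card =
      ∑ _q ∈ Q.filter (IsCut b w Q S), (X : ℚ[X]) ^ S.card := by
    intro S hS
    have hS := mem_ncFamilies.1 hS
    rw [Finset.sum_const, Finset.sum_const, card_visible_eq_card_isUncovered hv hT hS.nonempty
      (fun B hB => hS.subset hB) hS.disj, card_isUncovered_eq_card_isCut hv hS]
  rw [Finset.sum_congr rfl h1]
  simp only [Finset.sum_filter]
  rw [Finset.sum_comm]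
  refine Finset.sum_congr rfl fun q _ => ?_
  rw [← sum_isCut hv q, Finset.sum_filter]

/-- The slopes are distinct, so the lower parts have each of the sizes 1, ..., |Q| exactly once. -/
theorem sum_card_lowerPart {M : Type*} [AddCommMonoid M] (hv : IsView b w Q) (g : ℕ → M) :
    ∑ q ∈ Q, g (lowerPart b w Q q).card = ∑ i ∈ Finset.range Q.card, g (i + 1) := by
  induction Q using Finset.induction_on_max_value (slope b w) with
  | empty => simp
  | insert a s ha hmax ih =>
    have hlt : ∀ x ∈ s, slope b w x < slope b w a := fun x hx =>
      lt_of_le_of_ne (hmax x hx) fun h => ha ((hv.inj x (Finset.mem_insert_of_mem hx) a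
        (Finset.mem_insert_self a s) h) ▸ hx)
    have h1 : lowerPart b w (insert a s) a = insert a s :=
      Finset.filter_true_of_mem fun x hx => by
        rcases Finset.mem_insert.1 hx with rfl | hx
        · exact le_rfl
        · exact hmax x hx
    have h2 : ∀ q ∈ s, lowerPart b w (insert a s) q = lowerPart b w s q := fun q hq => by
      rw [lowerPart, Finset.filter_insert, if_neg (not_le.2 (hlt q hq)), lowerPart]
    rw [Finset.sum_insert ha, h1, Finset.card_insert_of_notMem ha, Finset.sum_range_succ, add_comm,
      Finset.sum_congr rfl fun q hq => by rw [h2 q hq], ih (hv.mono (Finset.subset_insert a s))]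

theorem card_upperPart (q : ℂ) :
    (upperPart b w Q q).card = Q.card - (lowerPart b w Q q).card := by
  have := Finset.card_filter_add_card_filter_not (s := Q) (fun x => slope b w x ≤ slope b w q)
  simp only [not_le] at this
  rw [upperPart, lowerPart]
  omega

theorem ncFamilies_empty : ncFamilies ∅ = {∅} := by
  ext S
  rw [mem_ncFamilies, Finset.mem_singleton]
  constructor
  · intro h
    rw [Finset.eq_empty_iff_forall_notMem]
    intro B hB
    obtain ⟨x, hx⟩ := h.nonempty B hB
    exact Finset.notMem_empty x (h.subset hB hx)
  · rintro rfl
    exact ⟨by simp, by simp, by simp⟩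

theorem ncPoly_eq_narayanaPoly (hG : GeneralPosition P) (hT : TriangleCondition P) :
    ncPoly P = narayanaPoly P.card := by
  induction hn : P.card using Nat.strong_induction_on generalizing P with
  | _ n ih =>
    rcases P.eq_empty_or_nonempty with rfl | hne
    · subst hn
      rw [ncPoly, ncFamilies_empty]
      simp [narayanaPoly]
    · obtain ⟨b, hb, w, hv⟩ := exists_isView hG hne
      have hins := Finset.insert_erase hb
      set Q := P.erase b
      have hQP : Q ⊆ P := Finset.erase_subset b P
      have hcard : Q.card + 1 = n := by rw [← hn]; exact Finset.card_erase_add_one hb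
      have hsub : ∀ A ⊆ Q, ncPoly A = narayanaPoly A.card := fun A hA =>
        ih A.card (by have := Finset.card_le_card hA; omega) (hG.mono (hA.trans hQP))
          (hT.mono (hA.trans hQP)) rfl
      rw [← hins, ncPoly_insert hv (hins.symm ▸ hT), ← hcard, narayanaPoly_succ, hsub Q subset_rfl]
      congr 1
      have h1 : ∀ i, Q.card - 1 - i = Q.card - (i + 1) := fun i => by omega
      simp only [h1]
      rw [← sum_card_lowerPart hv
        (fun i => narayanaPoly i * narayanaPoly (Q.card - i))]
      refine Finset.sum_congr rfl fun q _ => ?_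
      rw [hsub _ (lowerPart_subset q), hsub _ (upperPart_subset q), card_upperPart]

end PlanarNC

/-! ### Two-block coarsenings and splitting a block -/

namespace PlanarNC

variable {b w : ℂ} {P Q A B D U V : Finset ℂ} {S T : Finset (Finset ℂ)}

/-- `{U, V}` is a noncrossing partition of `P` that is coarser than `S`. -/
structure IsSplit (P : Finset ℂ) (S : Finset (Finset ℂ)) (U V : Finset ℂ) : Prop where
  left : U.Nonempty
  right : V.Nonempty
  disj : Disjoint (convexHull ℝ (U : Set ℂ)) (convexHull ℝ (V : Set ℂ))
  mem_iff : ∀ x, x ∈ P ↔ x ∈ U ∨ x ∈ V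
  subset_or : ∀ B ∈ S, B ⊆ U ∨ B ⊆ V

theorem IsSplit.symm (h : IsSplit P S U V) : IsSplit P S V U :=
  ⟨h.right, h.left, h.disj.symm, fun x => (h.mem_iff x).trans or_comm,
    fun B hB => (h.subset_or B hB).symm⟩

theorem IsSplit.join (h : IsSplit Q T U V) (hB : B ⊆ U) (hF : ¬ InFront b V U) :
    IsSplit (insert b Q) (insert (insert b B) (T.erase B)) (insert b U) V where
  left := Finset.insert_nonempty b U
  right := h.right
  disj := (not_inFront_iff.1 hF).symm
  mem_iff x := by rw [Finset.mem_insert, Finset.mem_insert, h.mem_iff, or_assoc]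
  subset_or A hA := by
    rcases Finset.mem_insert.1 hA with rfl | hA
    · exact Or.inl (Finset.insert_subset_insert b hB)
    · exact (h.subset_or A (Finset.mem_of_mem_erase hA)).imp_left
        fun h' => h'.trans (Finset.subset_insert b U)

/-- The block with the largest right slope is uncovered, so the number of visible blocks is
positive. -/
theorem exists_isVisible (hv : IsView b w Q) (hT : TriangleCondition (insert b Q))
    (hS : S.Nonempty) (hne : ∀ B ∈ S, B.Nonempty) (hsub : ∀ B ∈ S, B ⊆ Q)
    (hdisj : ∀ A ∈ S, ∀ B ∈ S, A ≠ B →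
      Disjoint (convexHull ℝ (A : Set ℂ)) (convexHull ℝ (B : Set ℂ))) :
    ∃ B ∈ S, IsVisible b S B := by
  classical
  obtain ⟨C, hC, hmax⟩ := S.exists_max_image (rightSlope b w) hS
  have h1 : 0 < (S.filter (IsUncovered b w S)).card := by
    refine Finset.card_pos.2 ⟨C, Finset.mem_filter.2 ⟨hC, fun D hD _ h => ?_⟩⟩
    exact absurd h.2 (not_lt.2 (hmax D hD))
  rw [← card_visible_eq_card_isUncovered hv hT hne hsub hdisj] at h1
  obtain ⟨B, hB⟩ := Finset.card_pos.1 h1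
  exact ⟨B, Finset.mem_filter.1 hB⟩

/-- Adding b to U fails only if V hides part of U. Then U hides no part of V, so a block visible
among those inside V is visible in T. Together with B there are two visible blocks, hence two cuts.
The one of smaller slope has points on both sides, and b may be added to either side. -/
theorem IsSplit.exists_join (hv : IsView b w Q) (hT : TriangleCondition (insert b Q))
    (hS : IsNCFamily Q T) (hBT : B ∈ T) (hB : IsVisible b T B) (h : IsSplit Q T U V)
    (hBU : B ⊆ U) :
    ∃ U V, IsSplit (insert b Q) (insert (insert b B) (T.erase B)) U V := by
  classical
  by_cases hF : InFront b V U
  swap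
  · exact ⟨_, _, h.join hBU hF⟩
  have hUQ : U ⊆ Q := fun x hx => (h.mem_iff x).2 (Or.inl hx)
  have hVQ : V ⊆ Q := fun x hx => (h.mem_iff x).2 (Or.inr hx)
  have hUV := disjoint_of_disjoint_hull h.disj
  have hF' : ¬ InFront b U V := hF.asymm (hv.mono hVQ) (hv.mono hUQ) h.right h.left h.disj.symm
  obtain ⟨E, hE, hEvis⟩ : ∃ E ∈ T.filter (· ⊆ V), IsVisible b (T.filter (· ⊆ V)) E := by
    refine exists_isVisible hv hT ?_ (fun B hB => hS.nonempty B (Finset.mem_filter.1 hB).1)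
      (fun B hB => hS.subset (Finset.mem_filter.1 hB).1)
      (fun A hA B hB => hS.disj A (Finset.mem_filter.1 hA).1 B (Finset.mem_filter.1 hB).1)
    obtain ⟨x, hx⟩ := h.right
    obtain ⟨D, hD, hxD⟩ := (hS.mem_iff x).1 (hVQ hx)
    exact ⟨D, Finset.mem_filter.2 ⟨hD, (h.subset_or D hD).resolve_left fun h' =>
      Finset.disjoint_left.1 hUV (h' hxD) hx⟩⟩
  obtain ⟨hET, hEV⟩ := Finset.mem_filter.1 hE
  have hEvis' : IsVisible b T E := by
    intro A hA hAE hAF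
    rcases h.subset_or A hA with h' | h'
    · exact hF' (hAF.mono h' hEV)
    · exact hEvis A (Finset.mem_filter.2 ⟨hA, h'⟩) hAE hAF
  have hBE : B ≠ E := by
    rintro rfl
    obtain ⟨x, hx⟩ := hS.nonempty B hBT
    exact Finset.disjoint_left.1 hUV (hBU hx) (hEV hx)
  have hcard : 1 < (Q.filter (IsCut b w Q T)).card := by
    rw [← card_isUncovered_eq_card_isCut hv hS, ← card_visible_eq_card_isUncovered hv hT
      hS.nonempty (fun B hB => hS.subset hB) hS.disj]
    exact Finset.one_lt_card.2 ⟨B, Finset.mem_filter.2 ⟨hBT, hB⟩, E,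
      Finset.mem_filter.2 ⟨hET, hEvis'⟩, hBE⟩
  obtain ⟨q, hq, q', hq', hcut, hlt⟩ : ∃ q ∈ Q, ∃ q' ∈ Q, IsCut b w Q T q ∧
      slope b w q < slope b w q' := by
    obtain ⟨q, hq, q', hq', hne⟩ := Finset.one_lt_card.1 hcard
    obtain ⟨h1, h2⟩ := Finset.mem_filter.1 hq
    obtain ⟨h1', h2'⟩ := Finset.mem_filter.1 hq'
    rcases lt_trichotomy (slope b w q) (slope b w q') with hlt | heq | hlt
    · exact ⟨q, h1, q', h1', h2, hlt⟩
    · exact absurd (hv.inj q h1 q' h1' heq) hne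
    · exact ⟨q', h1', q, h1, h2', hlt⟩
  have hL : (lowerPart b w Q q).Nonempty := ⟨q, mem_lowerPart.2 ⟨hq, le_rfl⟩⟩
  have hR : (upperPart b w Q q).Nonempty := ⟨q', mem_upperPart.2 ⟨hq', hlt⟩⟩
  have hLR := not_inFront_lower_upper hv (subset_refl (lowerPart b w Q q))
    (subset_refl (upperPart b w Q q)) hL hR
  have hsplit : IsSplit Q T (lowerPart b w Q q) (upperPart b w Q q) := by
    refine ⟨hL, hR, disjoint_hull_of_not_inFront hLR.1, fun x => ?_, hcut⟩
    rw [mem_lowerPart, mem_upperPart, ← and_or_left]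
    simp [le_or_gt]
  rcases hcut B hBT with h' | h'
  · exact ⟨_, _, hsplit.join h' hLR.2⟩
  · exact ⟨_, _, hsplit.symm.join h' hLR.1⟩

/-- Induction on the number of points: a block {b} is split off from Q; otherwise b is taken out of
its block, and a split of the rest is extended or replaced when b returns. -/
theorem exists_isSplit (hG : GeneralPosition P) (hT : TriangleCondition P)
    (hS : IsNCFamily P S) (h2 : 2 ≤ S.card) : ∃ U V, IsSplit P S U V := by
  induction hn : P.card using Nat.strong_induction_on generalizing P S with
  | _ n ih =>
    have hne : P.Nonempty := by
      obtain ⟨B, hB⟩ := Finset.card_pos.1 (show 0 < S.card by omega)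
      exact (hS.nonempty B hB).mono (hS.subset hB)
    obtain ⟨b, hb, w, hv⟩ := exists_isView hG hne
    have hQP : P.erase b ⊆ P := Finset.erase_subset b P
    have hcard : (P.erase b).card + 1 = n := by rw [← hn]; exact Finset.card_erase_add_one hb
    have hG' := hG.mono hQP
    have hT' := hT.mono hQP
    rw [← Finset.insert_erase hb] at hS hT ⊢
    set Q := P.erase b
    by_cases hbS : {b} ∈ S
    · have hSe := hS.erase_singleton hv.notMem hbS
      have hQ : Q.Nonempty := by
        obtain ⟨B, hB⟩ := Finset.card_pos.1
          (show 0 < (S.erase {b}).card by rw [Finset.card_erase_of_mem hbS]; omega)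
        exact (hSe.nonempty B hB).mono (hSe.subset hB)
      refine ⟨{b}, Q, Finset.singleton_nonempty b, hQ, ?_, fun x => by simp, fun B hB => ?_⟩
      · rw [Finset.coe_singleton, convexHull_singleton, Set.disjoint_singleton_left]
        exact hv.notMem_hull
      · by_cases hBb : B = {b}
        · exact Or.inl hBb.subset
        · exact Or.inr (hSe.subset (Finset.mem_erase.2 ⟨hBb, hB⟩))
    · obtain ⟨T, B, hTQ, hBT, hvis, rfl⟩ := hS.exists_join hv.notMem hbS
      rw [hTQ.card_join hv.notMem hBT] at h2
      obtain ⟨U, V, hUV⟩ := ih Q.card (by omega) hG' hT' hTQ h2 rfl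
      rcases hUV.subset_or B hBT with h | h
      · exact hUV.exists_join hv hT hTQ hBT hvis h
      · exact hUV.symm.exists_join hv hT hTQ hBT hvis h

/-- A block C of T outside S contains at least two blocks of S; `exists_isSplit` inside C cuts it in
two without breaking any of them. -/
theorem IsNCFamily.split_block (hG : GeneralPosition P) (hT : TriangleCondition P)
    (hS : IsNCFamily P S) (hR : IsNCFamily P T) (hST : ∀ B ∈ S, ∃ C ∈ T, B ⊆ C)
    (hne : ∃ C ∈ T, C ∉ S) :
    ∃ T', IsNCFamily P T' ∧ (∀ B ∈ S, ∃ C ∈ T', B ⊆ C) ∧ (∀ B ∈ T', ∃ C ∈ T, B ⊆ C) ∧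
      T'.card = T.card + 1 := by
  classical
  obtain ⟨C, hC, hCS⟩ := hne
  have hsub : ∀ B ∈ S, B ⊆ C ∨ Disjoint B C := by
    intro B hB
    obtain ⟨C', hC', hBC⟩ := hST B hB
    by_cases h : C' = C
    · exact Or.inl (h ▸ hBC)
    · exact Or.inr ((disjoint_of_disjoint_hull (hR.disj C' hC' C hC h)).mono_left hBC)
  have hres := hS.restrict (hR.subset hC) hsub
  have hcard : 2 ≤ (S.filter fun B => B ⊆ C).card := by
    obtain ⟨x, hx⟩ := hR.nonempty C hC
    obtain ⟨B, hB, hxB⟩ := (hres.mem_iff x).1 hx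
    obtain ⟨hBS, hBC⟩ := Finset.mem_filter.1 hB
    have hss : B ⊂ C := lt_of_le_of_ne hBC fun h => hCS (h ▸ hBS)
    obtain ⟨y, hy, hyB⟩ := Finset.exists_of_ssubset hss
    obtain ⟨D, hD, hyD⟩ := (hres.mem_iff y).1 hy
    exact Finset.one_lt_card.2 ⟨B, hB, D, hD, fun h => hyB (h ▸ hyD)⟩
  obtain ⟨U, V, h⟩ := exists_isSplit (hG.mono (hR.subset hC)) (hT.mono (hR.subset hC)) hres hcard
  have hUC : U ⊆ C := fun x hx => (h.mem_iff x).2 (Or.inl hx)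
  have hVC : V ⊆ C := fun x hx => (h.mem_iff x).2 (Or.inr hx)
  have hdU : ∀ A ∈ T.erase C, ∀ W ⊆ C, Disjoint (convexHull ℝ (A : Set ℂ))
      (convexHull ℝ (W : Set ℂ)) := fun A hA W hW =>
    (hR.disj A (Finset.mem_of_mem_erase hA) C hC (Finset.ne_of_mem_erase hA)).mono_right
      (convexHull_mono (by exact_mod_cast hW))
  have hnot : ∀ W ⊆ C, W.Nonempty → W ∉ T.erase C := fun W hW ⟨x, hx⟩ hWT =>
    Finset.ne_of_mem_erase hWT (hR.eq_of_mem (Finset.mem_of_mem_erase hWT) hC hx (hW hx))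
  have hUV : U ≠ V := by
    rintro rfl
    obtain ⟨x, hx⟩ := h.left
    exact Finset.disjoint_left.1 (disjoint_of_disjoint_hull h.disj) hx hx
  have mem_T' : ∀ A, A ∈ insert U (insert V (T.erase C)) ↔ A = U ∨ A = V ∨ A ∈ T.erase C :=
    fun A => by rw [Finset.mem_insert, Finset.mem_insert]
  refine ⟨insert U (insert V (T.erase C)), ⟨?_, ?_, ?_⟩, ?_, ?_, ?_⟩
  · intro A hA
    rcases (mem_T' A).1 hA with rfl | rfl | hA
    · exact h.left
    · exact h.right
    · exact hR.nonempty A (Finset.mem_of_mem_erase hA)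
  · intro A hA D hD hAD
    rcases (mem_T' A).1 hA with rfl | rfl | hA' <;> rcases (mem_T' D).1 hD with rfl | rfl | hD'
    · exact absurd rfl hAD
    · exact h.disj
    · exact (hdU D hD' A hUC).symm
    · exact h.disj.symm
    · exact absurd rfl hAD
    · exact (hdU D hD' A hVC).symm
    · exact hdU A hA' D hUC
    · exact hdU A hA' D hVC
    · exact hR.disj A (Finset.mem_of_mem_erase hA') D (Finset.mem_of_mem_erase hD') hAD
  · intro x
    rw [hR.mem_iff]
    constructor
    · rintro ⟨A, hA, hxA⟩
      by_cases hAC : A = C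
      · subst hAC
        rcases (h.mem_iff x).1 hxA with hx | hx
        · exact ⟨U, (mem_T' U).2 (Or.inl rfl), hx⟩
        · exact ⟨V, (mem_T' V).2 (Or.inr (Or.inl rfl)), hx⟩
      · exact ⟨A, (mem_T' A).2 (Or.inr (Or.inr (Finset.mem_erase.2 ⟨hAC, hA⟩))), hxA⟩
    · rintro ⟨A, hA, hxA⟩
      rcases (mem_T' A).1 hA with rfl | rfl | hA
      · exact ⟨C, hC, hUC hxA⟩
      · exact ⟨C, hC, hVC hxA⟩
      · exact ⟨A, Finset.mem_of_mem_erase hA, hxA⟩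
  · intro B hB
    obtain ⟨C', hC', hBC⟩ := hST B hB
    by_cases hCC : C' = C
    · subst hCC
      rcases h.subset_or B (Finset.mem_filter.2 ⟨hB, hBC⟩) with h' | h'
      · exact ⟨U, (mem_T' U).2 (Or.inl rfl), h'⟩
      · exact ⟨V, (mem_T' V).2 (Or.inr (Or.inl rfl)), h'⟩
    · exact ⟨C', (mem_T' C').2 (Or.inr (Or.inr (Finset.mem_erase.2 ⟨hCC, hC'⟩))), hBC⟩
  · intro B hB
    rcases (mem_T' B).1 hB with rfl | rfl | hB
    · exact ⟨C, hC, hUC⟩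
    · exact ⟨C, hC, hVC⟩
    · exact ⟨B, Finset.mem_of_mem_erase hB, subset_rfl⟩
  · rw [Finset.card_insert_of_notMem, Finset.card_insert_of_notMem (hnot V hVC h.right),
      Finset.card_erase_add_one hC]
    rw [Finset.mem_insert]
    rintro (h' | h')
    · exact hUV h'
    · exact hnot U hUC h.left h'

/-! ### The triangle condition for Δ_1 sets and convex polygons -/

/-- A vertex has a vanishing barycentric coordinate, whereas those of an interior point are all
positive. Hence triples are convex sets and Δ_1 applies to them. -/
theorem notMem_interior_triangle_of_mem {a b c : ℂ} (h : ¬ Collinear ℝ ({a, b, c} : Set ℂ))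
    {x : ℂ} (hx : x ∈ ({a, b, c} : Set ℂ)) :
    x ∉ interior (convexHull ℝ ({a, b, c} : Set ℂ)) := by
  have hi : AffineIndependent ℝ ![a, b, c] := affineIndependent_iff_not_collinear_set.2 h
  have htot : affineSpan ℝ (Set.range ![a, b, c]) = ⊤ :=
    hi.affineSpan_eq_top_iff_card_eq_finrank_add_one.2 (by simp [Complex.finrank_real_complex])
  let B : AffineBasis (Fin 3) ℝ ℂ := ⟨![a, b, c], hi, htot⟩
  have hrange : Set.range B = {a, b, c} := by
    show Set.range ![a, b, c] = _
    simp only [Matrix.range_cons, Matrix.range_empty, Set.union_empty]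
    rfl
  have hint := B.interior_convexHull
  rw [hrange] at hint
  rw [hint]
  rw [← hrange] at hx
  obtain ⟨j, rfl⟩ := hx
  intro h'
  have hj : j + 1 ≠ j := by fin_cases j <;> decide
  have := h' (j + 1)
  rw [B.coord_apply_ne hj] at this
  exact lt_irrefl _ this

theorem PropertyDelta.triangleCondition (h : PropertyDelta 1 P) : TriangleCondition P := by
  intro a ha b hb c hc hab hac hbc x hx y hy hx' hy'
  have hcoe : (({a, b, c} : Finset ℂ) : Set ℂ) = {a, b, c} := by push_cast; rfl
  have hcard : ({a, b, c} : Finset ℂ).card = 3 := Finset.card_eq_three.2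
    ⟨a, b, c, hab, hac, hbc, rfl⟩
  have hconv : IsConvexSubset {a, b, c} := by
    rw [IsConvexSubset, interiorPoints, Set.eq_empty_iff_forall_notMem]
    rintro z ⟨hz, hz'⟩
    rw [hcoe] at hz hz'
    exact notMem_interior_triangle_of_mem (h.1 a ha b hb c hc hab hac hbc) hz' hz
  have hsub : ({a, b, c} : Finset ℂ) ⊆ P := by
    intro z hz
    simp only [Finset.mem_insert, Finset.mem_singleton] at hz
    rcases hz with rfl | rfl | rfl <;> assumption
  -- For a triple the bound is (3 - 3) + 1 = 1.
  have hle := h.2 _ hsub hcard.ge hconv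
  rw [hcard] at hle
  have hfin : (interiorPoints P {a, b, c}).Finite := P.finite_toSet.subset Set.inter_subset_right
  refine (Set.ncard_le_one hfin).1 (by simpa using hle) x ⟨?_, hx⟩ y ⟨?_, hy⟩
  · rw [hcoe]; exact hx'
  · rw [hcoe]; exact hy'

theorem IsConvexPolygon.generalPosition (h : IsConvexPolygon P) : GeneralPosition P := by
  have key : ∀ x ∈ P, ∀ y ∈ P, ∀ z ∈ P, x ≠ y → y ≠ z → ¬ Wbtw ℝ x y z := by
    intro x hx y hy z hz hxy hyz hw
    refine h y hy (segment_subset_convexHull (𝕜 := ℝ) (x := x) (y := z) ?_ ?_ ?_)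
    · exact ⟨by exact_mod_cast hx, by simpa using hxy⟩
    · exact ⟨by exact_mod_cast hz, by simpa using hyz.symm⟩
    · rwa [mem_segment_iff_wbtw]
  intro a ha b hb c hc hab hac hbc hcol
  rcases hcol.wbtw_or_wbtw_or_wbtw with hw | hw | hw
  · exact key a ha b hb c hc hab hbc hw
  · exact key b hb c hc a ha hbc hac.symm hw
  · exact key c hc a ha b hb hac.symm hab hw

/-- The condition is vacuous: no point of P is interior to such a triangle. -/
theorem IsConvexPolygon.triangleCondition (h : IsConvexPolygon P) : TriangleCondition P := by
  intro a ha b hb c hc hab hac hbc x hx y _ hx' _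
  exfalso
  by_cases hxm : x ∈ ({a, b, c} : Set ℂ)
  · exact notMem_interior_triangle_of_mem (h.generalPosition a ha b hb c hc hab hac hbc) hxm hx'
  · refine h x hx (convexHull_mono ?_ (interior_subset hx'))
    intro z hz
    refine ⟨?_, fun hzx => hxm (Set.mem_singleton_iff.1 hzx ▸ hz)⟩
    rcases hz with rfl | rfl | rfl <;> assumption

end PlanarNC

/-! ### From families of blocks to the poset: counts, lattice, rank -/

namespace PlanarNC
open Polynomial

variable {P : Finset ℂ} {S : Finset (Finset ℂ)}

theorem isNCFamily_parts (π : NC P) : IsNCFamily P π.1.parts where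
  nonempty _ hB := π.1.nonempty_of_mem_parts hB
  disj _ hA _ hB hAB := π.2 hA hB hAB
  mem_iff _ := ⟨fun hx => π.1.exists_mem hx, fun ⟨_, hB, hx⟩ => π.1.le hB hx⟩

/-- The noncrossing partition with a given family of blocks. -/
def IsNCFamily.toNC (h : IsNCFamily P S) : NC P :=
  ⟨{ parts := S
     supIndep := Finset.supIndep_iff_pairwiseDisjoint.2 fun A hA B hB hAB =>
       disjoint_of_disjoint_hull (h.disj A hA B hB hAB)
     sup_parts := by
       ext x
       rw [Finset.mem_sup, h.mem_iff x]
       rfl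
     bot_notMem := fun hb => Finset.not_nonempty_empty (h.nonempty _ hb) },
    fun A hA B hB hAB => h.disj A hA B hB hAB⟩

theorem IsNCFamily.parts_toNC (h : IsNCFamily P S) : h.toNC.1.parts = S := rfl

theorem NC.ext_parts {π σ : NC P} (h : π.1.parts = σ.1.parts) : π = σ :=
  Subtype.ext (Finpartition.ext h)

theorem NC.ncard_eq (p : Finset (Finset ℂ) → Prop) [DecidablePred p] :
    {π : NC P | p π.1.parts}.ncard = ((ncFamilies P).filter p).card := by
  rw [← Set.ncard_coe_finset]
  refine Set.ncard_congr (fun π _ => π.1.parts) ?_ ?_ ?_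
  · intro π hπ
    simp only [Finset.coe_filter, Set.mem_ofPred_eq]
    exact ⟨mem_ncFamilies.2 (isNCFamily_parts π), hπ⟩
  · intro π σ _ _ h
    exact NC.ext_parts h
  · intro S hS
    simp only [Finset.coe_filter, Set.mem_ofPred_eq] at hS
    exact ⟨(mem_ncFamilies.1 hS.1).toNC, hS.2, rfl⟩

theorem coeff_ncPoly (P : Finset ℂ) (k : ℕ) :
    (ncPoly P).coeff k = ((ncFamilies P).filter fun S => S.card = k).card := by
  rw [ncPoly, finsetSum_coeff]
  simp only [coeff_X_pow, Finset.sum_boole]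
  congr 2
  ext S
  simp [eq_comm]

theorem eval_one_ncPoly (P : Finset ℂ) : (ncPoly P).eval 1 = (ncFamilies P).card := by
  rw [ncPoly, eval_finsetSum]
  simp

theorem natCard_NC (hG : GeneralPosition P) (hT : TriangleCondition P) :
    Nat.card (NC P) = catalan P.card := by
  have h1 : Nat.card (NC P) = (ncFamilies P).card := by
    have := NC.ncard_eq (P := P) fun _ => True
    simpa [Set.ncard_univ] using this
  have h2 := eval_one_ncPoly P
  rw [ncPoly_eq_narayanaPoly hG hT, eval_one_narayanaPoly] at h2
  rw [h1]
  exact_mod_cast h2.symm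

theorem card_parts_le (π : NC P) : π.1.parts.card ≤ P.card := π.1.card_parts_le_card

theorem rankCount_eq (hG : GeneralPosition P) (hT : TriangleCondition P) {k : ℕ}
    (hk : k < P.card) : (rankCount P k : ℚ) = narayana P.card (k + 1) := by
  have h1 : {π : NC P | rank π = k} = {π : NC P | π.1.parts.card = P.card - k} := by
    ext π
    have := card_parts_le π
    simp only [Set.mem_ofPred_eq, rank]
    omega
  rw [rankCount, h1, NC.ncard_eq (fun S => S.card = P.card - k), ← coeff_ncPoly,
    ncPoly_eq_narayanaPoly hG hT]
  obtain ⟨n, hn⟩ : ∃ n, P.card = n + 1 := ⟨P.card - 1, by omega⟩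
  -- Rank k means n - k blocks, and N_{n,n-k} = N_{n,k+1} by the symmetry of binomial coefficients.
  obtain ⟨j, hj⟩ : ∃ j, P.card - k = j + 1 := ⟨P.card - k - 1, by omega⟩
  rw [hj, hn, coeff_narayanaPoly, narayana, narayana, Nat.add_sub_cancel, Nat.add_sub_cancel,
    show j + 1 = n + 1 - k by omega, Nat.choose_symm (by omega), show j = n + 1 - (k + 1) by omega,
    Nat.choose_symm (by omega)]
  ring

theorem narayana_symm {n i j : ℕ} (h : i + j = n - 1) (hn : 1 ≤ n) :
    narayana n (i + 1) = narayana n (j + 1) := by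
  rw [narayana, narayana, Nat.add_sub_cancel, Nat.add_sub_cancel,
    show j + 1 = n - i by omega, Nat.choose_symm (by omega), show j = n - (i + 1) by omega,
    Nat.choose_symm (by omega)]
  ring

/-- Distinct blocks of the meet lie in distinct blocks of π or of σ, whose hulls are already
disjoint. -/
theorem isNoncrossing_inf {π σ : Finpartition P} (hπ : IsNoncrossing π) (hσ : IsNoncrossing σ) :
    IsNoncrossing (π ⊓ σ) := by
  intro A hA B hB hAB
  rw [Finset.mem_coe, Finpartition.parts_inf, Finset.mem_erase, Finset.mem_image] at hA hB
  obtain ⟨-, ⟨A₁, A₂⟩, hA, rfl⟩ := hA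
  obtain ⟨-, ⟨B₁, B₂⟩, hB, rfl⟩ := hB
  obtain ⟨hA₁, hA₂⟩ := Finset.mem_product.1 hA
  obtain ⟨hB₁, hB₂⟩ := Finset.mem_product.1 hB
  by_cases h1 : A₁ = B₁
  · by_cases h2 : A₂ = B₂
    · exact absurd (by rw [h1, h2]) hAB
    · exact (hσ hA₂ hB₂ h2).mono (convexHull_mono (by exact_mod_cast inf_le_right))
        (convexHull_mono (by exact_mod_cast inf_le_right))
  · exact (hπ hA₁ hB₁ h1).mono (convexHull_mono (by exact_mod_cast inf_le_left))
      (convexHull_mono (by exact_mod_cast inf_le_left))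

theorem NC.le_iff {π σ : NC P} : π ≤ σ ↔ ∀ B ∈ π.1.parts, ∃ C ∈ σ.1.parts, B ⊆ C := Iff.rfl

theorem isNCFamily_singleton (hP : P.Nonempty) : IsNCFamily P {P} :=
  ⟨by simpa using hP, by simp +contextual, by simp⟩

theorem isNCFamily_empty : IsNCFamily ∅ ∅ := ⟨by simp, by simp, by simp⟩

theorem exists_forall_le (P : Finset ℂ) : ∃ τ : NC P, ∀ π : NC P, π ≤ τ := by
  rcases P.eq_empty_or_nonempty with rfl | hP
  · refine ⟨isNCFamily_empty.toNC, fun π B hB => ?_⟩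
    obtain ⟨x, hx⟩ := (isNCFamily_parts π).nonempty B hB
    exact absurd ((isNCFamily_parts π).subset hB hx) (Finset.notMem_empty x)
  · exact ⟨(isNCFamily_singleton hP).toNC, fun π B hB =>
      ⟨P, Finset.mem_singleton_self P, (isNCFamily_parts π).subset hB⟩⟩

theorem exists_isGLB_isLUB (π σ : NC P) :
    (∃ μ : NC P, IsGLB {π, σ} μ) ∧ (∃ ν : NC P, IsLUB {π, σ} ν) := by
  let _ : SemilatticeInf (NC P) := Subtype.semilatticeInf fun _ _ => isNoncrossing_inf
  refine ⟨⟨π ⊓ σ, isGLB_pair⟩, ?_⟩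
  -- The join is the meet of all upper bounds, a finite set that is nonempty because a maximum
  -- exists.
  have hfin : (upperBounds {π, σ} : Set (NC P)).Finite := Set.toFinite _
  obtain ⟨τ, hτ⟩ := exists_forall_le P
  have hne : hfin.toFinset.Nonempty := ⟨τ, hfin.mem_toFinset.2 fun x _ => hτ x⟩
  refine ⟨hfin.toFinset.inf' hne id, fun x hx => ?_, fun x hx => ?_⟩
  · exact Finset.le_inf' hne id fun y hy => hfin.mem_toFinset.1 hy hx
  · exact Finset.inf'_le id (hfin.mem_toFinset.2 hx)

theorem rank_of_isMax {π : NC P} (h : IsMax π) : rank π = P.card - 1 := by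
  rcases P.eq_empty_or_nonempty with rfl | hP
  · simp [rank]
  · have hle : π ≤ (isNCFamily_singleton hP).toNC := fun B hB =>
      ⟨P, Finset.mem_singleton_self P, (isNCFamily_parts π).subset hB⟩
    rw [le_antisymm hle (h hle), rank, IsNCFamily.parts_toNC, Finset.card_singleton]

theorem isNoncrossing_bot : IsNoncrossing (⊥ : Finpartition P) := by
  intro A hA B hB hAB
  obtain ⟨a, -, rfl⟩ := Finpartition.mem_bot_iff.1 hA
  obtain ⟨b, -, rfl⟩ := Finpartition.mem_bot_iff.1 hB
  show Disjoint _ _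
  simpa using hAB

theorem rank_of_isMin {π : NC P} (h : IsMin π) : rank π = 0 := by
  have hle : (⟨⊥, isNoncrossing_bot⟩ : NC P) ≤ π := by
    show (⊥ : Finpartition P) ≤ π.1
    exact bot_le
  rw [le_antisymm (h hle) hle, rank, Finpartition.card_bot, Nat.sub_self]

/-- Gives both halves of gradedness: rank strictly increases, and under a covering relation τ must
be π, so it increases by one. -/
theorem exists_le_lt_card_eq (hG : GeneralPosition P) (hT : TriangleCondition P) {π σ : NC P}
    (h : π < σ) : ∃ τ : NC P, π ≤ τ ∧ τ < σ ∧ τ.1.parts.card = σ.1.parts.card + 1 := by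
  have hne : ∃ C ∈ σ.1.parts, C ∉ π.1.parts := by
    by_contra! hcon
    exact h.not_ge fun C hC => ⟨C, hcon C hC, le_rfl⟩
  obtain ⟨T, hT', h1, h2, h3⟩ := (isNCFamily_parts π).split_block hG hT (isNCFamily_parts σ)
    (NC.le_iff.1 h.le) hne
  refine ⟨hT'.toNC, NC.le_iff.2 h1, lt_of_le_of_ne (NC.le_iff.2 h2) fun he => ?_, h3⟩
  have : hT'.toNC.1.parts.card = σ.1.parts.card := by rw [he]
  rw [IsNCFamily.parts_toNC] at this
  omega

theorem card_parts_anti {π σ : NC P} (h : π ≤ σ) : σ.1.parts.card ≤ π.1.parts.card :=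
  Finpartition.card_mono h

theorem rank_lt_rank (hG : GeneralPosition P) (hT : TriangleCondition P) {π σ : NC P}
    (h : π < σ) : rank π < rank σ := by
  obtain ⟨τ, h1, -, h3⟩ := exists_le_lt_card_eq hG hT h
  have := card_parts_anti h1
  have := card_parts_le π
  simp only [rank]
  omega

theorem rank_covBy_rank (hG : GeneralPosition P) (hT : TriangleCondition P) {π σ : NC P}
    (h : π ⋖ σ) : rank π ⋖ rank σ := by
  obtain ⟨τ, h1, h2, h3⟩ := exists_le_lt_card_eq hG hT h.lt
  have hτ : π = τ := by
    by_contra hne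
    exact h.2 (lt_of_le_of_ne h1 hne) h2
  subst hτ
  have := card_parts_le π
  rw [Order.covBy_iff_add_one_eq]
  simp only [rank]
  omega

end PlanarNC

theorem theorem3p3 (P : Finset ℂ) (n : ℕ) (hn : P.card = n)
    (hP : PlanarNC.PropertyDelta 1 P) :
    -- `NC(P)` is a lattice
    (∀ π σ : PlanarNC.NC P,
      (∃ μ : PlanarNC.NC P, IsGLB {π, σ} μ) ∧ (∃ ν : PlanarNC.NC P, IsLUB {π, σ} ν)) ∧
    -- it is graded, with rank function `π ↦ n - bl(π)`
    (∃ _ : GradeMinOrder ℕ (PlanarNC.NC P), ∀ π : PlanarNC.NC P, grade ℕ π = PlanarNC.rank π) ∧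
    -- it is rank-symmetric: the ranks run from `0` to `n - 1`
    (∀ π : PlanarNC.NC P, IsMax π → PlanarNC.rank π = n - 1) ∧
    (∀ i j : ℕ, i + j = n - 1 → PlanarNC.rankCount P i = PlanarNC.rankCount P j) ∧
    -- the rank counts are the Narayana numbers
    (∀ k < n, (PlanarNC.rankCount P k : ℚ) = PlanarNC.narayana n (k + 1)) ∧
    -- the total is the Catalan number, as for the vertices of any convex `n`-gon
    Nat.card (PlanarNC.NC P) = catalan n ∧
    (∀ Q : Finset ℂ, Q.card = n → PlanarNC.IsConvexPolygon Q →
      Nat.card (PlanarNC.NC P) = Nat.card (PlanarNC.NC Q)) := by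
  have hG := hP.1
  have hT := hP.triangleCondition
  subst hn
  refine ⟨PlanarNC.exists_isGLB_isLUB, ⟨{
      grade := PlanarNC.rank
      grade_strictMono := fun _ _ h => PlanarNC.rank_lt_rank hG hT h
      covBy_grade := fun _ _ h => PlanarNC.rank_covBy_rank hG hT h
      isMin_grade := fun _ h => by
        rw [PlanarNC.rank_of_isMin h]
        exact isMin_bot }, fun _ => rfl⟩,
    fun _ h => PlanarNC.rank_of_isMax h, fun i j hij => ?_,
    fun k hk => PlanarNC.rankCount_eq hG hT hk, PlanarNC.natCard_NC hG hT, fun Q hQ hQ' => ?_⟩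
  · rcases Nat.eq_zero_or_pos P.card with h0 | h0
    -- For the empty set n - 1 is truncated to 0, leaving only i = j = 0.
    · obtain ⟨rfl, rfl⟩ : i = 0 ∧ j = 0 := by omega
      rfl
    · have h1 := PlanarNC.rankCount_eq hG hT (show i < P.card by omega)
      rw [PlanarNC.narayana_symm hij h0,
        ← PlanarNC.rankCount_eq hG hT (show j < P.card by omega)] at h1
      exact_mod_cast h1
  · rw [PlanarNC.natCard_NC hG hT,
      PlanarNC.natCard_NC hQ'.generalPosition hQ'.triangleCondition, hQ]
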